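/- \textbf{Theorem (asymptotic bias of naive averaging).} For each $n$ let $x$ be a random vector in $\mathbb{R}^{d}$, $d=d(n)$, with $\mathbb{E}[x]=0$ and $\mathrm{Cov}(x)=\Sigma_n$, let $x_1,\dots,x_n$ be i.i.d. samples of $x$, and let $\hat\Sigma_n=\frac1n\sum_{i=1}^n x_ix_i^T$. Let $n,d\to\infty$ with $d/n\to y\in[0,1)$. Let $\|\cdot\|$ be the spectral norm, and let $F_{\Sigma_n}(u)$ be the proportion of the eigenvalues of $\Sigma_n$, counted with multiplicity, that are at most $u$. Assume: (A1) there is a function $F_\Sigma$ with $F_{\Sigma_n}(u)\to F_\Sigma(u)$ for almost every $u\ge 0$; (A2) $\sup_{|e|=1}\mathbb{E}(e^Tx)^4$ is bounded in $n$, and $\sup_{\|B\|=1}\mathrm{Var}(x^TBx/d)\to 0$ (supremum over real $d\times d$ matrices); (A3) all eigenvalues of every $\Sigma_n$ lie in $[\sigma_{\min},\sigma_{\max}]$, where $\sigma_{\min}>0$ and $\sigma_{\min},\sigma_{\max}$ do not depend on $n$. Then $\mathbb{E}[(\hat\Sigma_n+\lambda I)^{-1}]$ exists for all $n$ and all $\lambda>0$,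 and: (1) For every sequence $\lambda_n>0$ with $\lambda_n\to0$, \[\liminf_{n\to\infty}\left\|\mathbb{E}\left[(\hat\Sigma_n+\lambda_n I)^{-1}\right]-(\Sigma_n+\lambda_n I)^{-1}\right\|\ \ge\ \frac{y\,\sigma_{\min}}{\sigma_{\max}^2}\] (the lower limit may be $+\infty$). (2) Let $\lambda>0$ be fixed, and put $\overline{d_{\mu}}=\liminf_{n\to\infty}\frac1n\mathrm{tr}\left(\Sigma_n(\Sigma_n+\mu I)^{-1}\right)$ for $\mu>0$. There is $\lambda'>0$ with $\lambda=\lambda'(1-\overline{d_{\lambda'}})$. For every such $\lambda'$ the limit $t=\lim_{n\to\infty}\frac1n\mathrm{tr}(\Sigma_n+\lambda' I)^{-1}$ exists, and \[\liminf_{n\to\infty}\left\|\mathbb{E}\left[(\hat\Sigma_n+\lambda I)^{-1}\right]-(\Sigma_n+\lambda I)^{-1}\right\|\ \ge\ \frac{\sigma_{\min}}{\sigma_{\max}+\lambda}\cdot\frac{\lambda'}{\lambda(\sigma_{\max}+\lambda')}\,\left|y-\lambda' t\right|\ \ge\ \frac{\lambda'\sigma_{\min}\,y}{\lambda(\sigma_{\max}+\lambda)(\sigma_{\max}+\lambda')}\cdot\frac{\sigma_{\min}}{\sigma_{\min}+\lambda'}.\]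 -/

import Mathlib

open MeasureTheory ProbabilityTheory Filter Topology
open scoped ENNReal Matrix Matrix.Norms.L2Operator

namespace NaiveAveraging

/-- The covariance matrix of a distribution on `ℝᵈ`. -/
noncomputable def covMatrix {d : ℕ} (D : Measure (EuclideanSpace ℝ (Fin d))) :
    Matrix (Fin d) (Fin d) ℝ :=
  Matrix.of fun i j => covariance (fun x => x i) (fun x => x j) D

theorem covMatrix_isHermitian {d : ℕ} (D : Measure (EuclideanSpace ℝ (Fin d))) :
    (covMatrix D).IsHermitian := by
  ext i j
  simp [covMatrix, Matrix.conjTranspose_apply, covariance_comm]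

/-- The empirical covariance `(1/n) ∑ xᵢ xᵢᵀ` of the sample `x₁, …, xₙ`. -/
noncomputable def sampleCov {n d : ℕ} (x : Fin n → EuclideanSpace ℝ (Fin d)) :
    Matrix (Fin d) (Fin d) ℝ :=
  (n : ℝ)⁻¹ • ∑ i, Matrix.vecMulVec (x i).ofLp (x i).ofLp

/-- The regularized inverse `(A + l I)⁻¹`. -/
noncomputable def regInv {d : ℕ} (A : Matrix (Fin d) (Fin d) ℝ) (l : ℝ) :
    Matrix (Fin d) (Fin d) ℝ :=
  (A + l • (1 : Matrix (Fin d) (Fin d) ℝ))⁻¹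

/-- The effective dimension `tr (A (A + l I)⁻¹)`. -/
noncomputable def effDim {d : ℕ} (A : Matrix (Fin d) (Fin d) ℝ) (l : ℝ) : ℝ :=
  (A * regInv A l).trace

/-- The empirical spectral distribution function: the proportion of the eigenvalues of `A`
(counted with multiplicity) that are at most `u`. -/
noncomputable def esd {d : ℕ} {A : Matrix (Fin d) (Fin d) ℝ} (hA : A.IsHermitian) (u : ℝ) : ℝ :=
  (d : ℝ)⁻¹ * (Finset.univ.filter fun i => hA.eigenvalues i ≤ u).card

/-- `M = sup_{|e| = 1} E (eᵀ x)⁴`, as an extended nonnegative real. -/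
noncomputable def fourthMoment {d : ℕ} (D : Measure (EuclideanSpace ℝ (Fin d))) : ℝ≥0∞ :=
  ⨆ (e : EuclideanSpace ℝ (Fin d)) (_ : ‖e‖ = 1),
    ∫⁻ x, ENNReal.ofReal ((inner ℝ e x) ^ 4) ∂D

/-- `ν = sup_{‖B‖ = 1} Var (xᵀ B x / d)`, as an extended nonnegative real; the supremum is over
the real `d × d` matrices of spectral norm `1`. -/
noncomputable def quadVar {d : ℕ} (D : Measure (EuclideanSpace ℝ (Fin d))) : ℝ≥0∞ :=
  ⨆ (B : Matrix (Fin d) (Fin d) ℝ) (_ : ‖B‖ = 1),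
    evariance (fun x => (x.ofLp ⬝ᵥ (B *ᵥ x.ofLp)) / (d : ℝ)) D

/-- The three standing assumptions on the sequence `D` of data distributions: the empirical
spectral distributions of the covariance matrices converge to `F` almost everywhere on `[0, ∞)`;
the fourth moments are bounded and the variances of normalized quadratic forms vanish; all
eigenvalues of the covariance matrices lie in `[smin, smax]`, where `smin > 0`. -/
structure StandingAssumptions {d : ℕ → ℕ} (D : ∀ n, Measure (EuclideanSpace ℝ (Fin (d n))))
    (F : ℝ → ℝ) (smin smax : ℝ) : Prop where
  esd_tendsto : ∀ᵐ u ∂(volume.restrict (Set.Ici (0 : ℝ))),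
    Tendsto (fun n => esd (covMatrix_isHermitian (D n)) u) atTop (𝓝 (F u))
  fourthMoment_lt_top : (⨆ n, fourthMoment (D n)) < ∞
  quadVar_tendsto : Tendsto (fun n => quadVar (D n)) atTop (𝓝 0)
  smin_pos : 0 < smin
  eigenvalues_mem : ∀ n i, (covMatrix_isHermitian (D n)).eigenvalues i ∈ Set.Icc smin smax

/-- `‖E (Σ̂ + l I)⁻¹ - (Σ + l I)⁻¹‖` in spectral norm, where `Σ` is the covariance matrix of `D`
and `Σ̂` is the empirical covariance of the sample `X`. -/
noncomputable def averagingBias {n d : ℕ} {Ω : Type*} [MeasurableSpace Ω] (P : Measure Ω)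
    (D : Measure (EuclideanSpace ℝ (Fin d))) (X : Fin n → Ω → EuclideanSpace ℝ (Fin d))
    (l : ℝ) : ℝ :=
  ‖(∫ ω, regInv (sampleCov fun i => X i ω) l ∂P) - regInv (covMatrix D) l‖

/-- The lower limit of the normalized effective dimensions `n⁻¹ tr (Σₙ (Σₙ + l I)⁻¹)`. -/
noncomputable def limEffDim {d : ℕ → ℕ} (D : ∀ n, Measure (EuclideanSpace ℝ (Fin (d n))))
    (l : ℝ) : ℝ :=
  liminf (fun n : ℕ => (n : ℝ)⁻¹ * effDim (covMatrix (D n)) l) atTop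

end NaiveAveraging

open NaiveAveraging

/-! The spectral norm is bounded below by duality: for positive semidefinite `W`, `|tr (W B)| ≤ ‖B‖
tr W`. Taking `W = Σ` reduces both bounds to the scalar `tr (Σ E R) - tr (Σ (Σ + l I)⁻¹)`, divided
by `tr Σ`, where `R = (Σ̂ + l I)⁻¹` (`le_averagingBias`).

The limit of `κ = tr (Σ R) / n` in expectation comes from a leave-one-out argument
(`abs_trace_sub_le`). By the rank one update formula, each sample enters `R` through a quotient `T /
(1 + q)` of quadratic forms of the resolvent without that sample. Independence and the variance
assumption make these forms concentrate at traces, and restoring the sample costs only `O(1/n)`.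
Hence `E R` behaves like `(1 + k) (Σ + l (1 + k) I)⁻¹`, where `k = (1 + k) d(l (1 + k))` and `d(m)`
is the limiting normalized effective dimension. With `l' = l (1 + k)` this is the equation `l = l'
(1 - d(l'))`. The error equation is linear in `κ - k` with a coefficient bounded away from zero, so
`κ` is compared with a given solution directly and no uniqueness is needed
(`tendsto_trace_integral`).

For fixed `l`, `tr (Σ E R)` is thus `(l'/l) tr (Σ (Σ + l' I)⁻¹)` up to `o(n)`, which exceeds `tr (Σ
(Σ + l I)⁻¹)` eigenvalue by eigenvalue (`effDim_add_le`). For vanishing regularization the trace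
only grows as `l` decreases, so it is compared with a small fixed level, where its normalized limit
`d/(1 - d)` is close to `y/(1 - y)`, while the population term is at most `y` in the limit. -/

namespace NaiveAveraging

/-! ### Resolvents of positive semidefinite matrices and rank one updates. -/

section Resolvent

variable {d : ℕ} {A B S W : Matrix (Fin d) (Fin d) ℝ} {l : ℝ}

theorem trace_mul_nonneg_of_posSemidef (hW : W.PosSemidef) (hB : B.PosSemidef) :
    0 ≤ (W * B).trace := by
  obtain ⟨m, v, rfl⟩ := Matrix.posSemidef_iff_eq_sum_vecMulVec.mp hW
  rw [Finset.sum_mul, Matrix.trace_sum]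
  refine Finset.sum_nonneg fun i _ => ?_
  rw [Matrix.vecMulVec_mul, Matrix.trace_vecMulVec, dotProduct_comm,
    ← Matrix.dotProduct_mulVec]
  exact hB.dotProduct_mulVec_nonneg _

theorem abs_dotProduct_mulVec_le (B : Matrix (Fin d) (Fin d) ℝ) (v : Fin d → ℝ) :
    |v ⬝ᵥ (B *ᵥ v)| ≤ ‖B‖ * (v ⬝ᵥ v) := by
  have h := Matrix.l2_opNorm_mulVec B (WithLp.toLp 2 v)
  have h2 := abs_real_inner_le_norm (WithLp.toLp 2 v : EuclideanSpace ℝ (Fin d))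
    (WithLp.toLp 2 (B *ᵥ v))
  have h3 : (v ⬝ᵥ v) = ‖(WithLp.toLp 2 v : EuclideanSpace ℝ (Fin d))‖ ^ 2 := by
    rw [EuclideanSpace.real_norm_sq_eq]
    simp [dotProduct, sq]
  have h4 : inner ℝ (WithLp.toLp 2 v : EuclideanSpace ℝ (Fin d)) (WithLp.toLp 2 (B *ᵥ v))
      = v ⬝ᵥ (B *ᵥ v) := by
    simp [PiLp.inner_apply, dotProduct, mul_comm]
  rw [← h4, h3]
  calc _ ≤ _ := h2
    _ ≤ ‖(WithLp.toLp 2 v : EuclideanSpace ℝ (Fin d))‖ *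
        (‖B‖ * ‖(WithLp.toLp 2 v : EuclideanSpace ℝ (Fin d))‖) := by gcongr; exact h
    _ = _ := by ring

/-- Duality between trace and spectral norm, obtained by splitting `W` into rank one terms. It turns
trace estimates into lower bounds on the norm of the bias. -/
theorem abs_trace_mul_le (hW : W.PosSemidef) (B : Matrix (Fin d) (Fin d) ℝ) :
    |(W * B).trace| ≤ ‖B‖ * W.trace := by
  obtain ⟨m, v, rfl⟩ := Matrix.posSemidef_iff_eq_sum_vecMulVec.mp hW
  rw [Finset.sum_mul, Matrix.trace_sum, Matrix.trace_sum, Finset.mul_sum]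
  refine (Finset.abs_sum_le_sum_abs _ _).trans (Finset.sum_le_sum fun i _ => ?_)
  rw [Matrix.vecMulVec_mul, Matrix.trace_vecMulVec, dotProduct_comm,
    ← Matrix.dotProduct_mulVec, Matrix.trace_vecMulVec]
  simpa using abs_dotProduct_mulVec_le B (v i)

theorem l2_opNorm_le_of_dotProduct_le {c : ℝ} (hc : 0 ≤ c)
    (h : ∀ v : Fin d → ℝ, (B *ᵥ v) ⬝ᵥ (B *ᵥ v) ≤ c ^ 2 * (v ⬝ᵥ v)) : ‖B‖ ≤ c := by
  rw [Matrix.cstar_norm_def]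
  refine ContinuousLinearMap.opNorm_le_bound _ hc fun x => ?_
  refine abs_le_of_sq_le_sq' ?_ (by positivity) |>.2
  have h3 : ∀ x : EuclideanSpace ℝ (Fin d), ‖x‖ ^ 2 = x.ofLp ⬝ᵥ x.ofLp := fun x => by
    rw [EuclideanSpace.real_norm_sq_eq]
    simp [dotProduct, sq]
  rw [mul_pow, h3, h3, Matrix.ofLp_toEuclideanCLM]
  exact h _

theorem posDef_add_smul_one (hA : A.PosSemidef) (hl : 0 < l) :
    (A + l • (1 : Matrix (Fin d) (Fin d) ℝ)).PosDef :=
  Matrix.PosDef.posSemidef_add hA (Matrix.PosDef.one.smul hl)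

theorem posDef_regInv (hA : A.PosSemidef) (hl : 0 < l) : (regInv A l).PosDef :=
  (posDef_add_smul_one hA hl).inv

theorem isUnit_det_add_smul_one (hA : A.PosSemidef) (hl : 0 < l) :
    IsUnit (A + l • (1 : Matrix (Fin d) (Fin d) ℝ)).det :=
  (Matrix.isUnit_iff_isUnit_det _).1 (posDef_add_smul_one hA hl).isUnit

theorem regInv_mul_add (hA : A.PosSemidef) (hl : 0 < l) :
    regInv A l * (A + l • 1) = 1 :=
  Matrix.nonsing_inv_mul _ (isUnit_det_add_smul_one hA hl)

theorem add_mul_regInv (hA : A.PosSemidef) (hl : 0 < l) :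
    (A + l • 1) * regInv A l = 1 :=
  Matrix.mul_nonsing_inv _ (isUnit_det_add_smul_one hA hl)

theorem mul_regInv (hA : A.PosSemidef) (hl : 0 < l) :
    A * regInv A l = 1 - l • regInv A l := by
  rw [eq_sub_iff_add_eq, ← add_mul_regInv hA hl, add_mul, smul_mul_assoc, one_mul]

theorem regInv_mul (hA : A.PosSemidef) (hl : 0 < l) :
    regInv A l * A = 1 - l • regInv A l := by
  rw [eq_sub_iff_add_eq, ← regInv_mul_add hA hl, mul_add, mul_smul_comm, mul_one]

theorem regInv_transpose (hA : A.PosSemidef) (hl : 0 < l) : (regInv A l)ᵀ = regInv A l := by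
  simpa [Matrix.IsHermitian] using (posDef_regInv hA hl).isHermitian

theorem dotProduct_mulVec_nonneg (hA : A.PosSemidef) (v : Fin d → ℝ) :
    0 ≤ v ⬝ᵥ (A *ᵥ v) := by
  simpa using hA.dotProduct_mulVec_nonneg v

/-- A vector dominates its image under the regularized inverse. -/
theorem dotProduct_regInv_mulVec_ge (hA : A.PosSemidef) (hl : 0 < l) (v : Fin d → ℝ) :
    l * ((regInv A l *ᵥ v) ⬝ᵥ (regInv A l *ᵥ v)) ≤ v ⬝ᵥ (regInv A l *ᵥ v) := by
  have h : v = A *ᵥ (regInv A l *ᵥ v) + l • (regInv A l *ᵥ v) := by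
    conv_lhs => rw [← Matrix.one_mulVec v, ← add_mul_regInv hA hl]
    rw [← Matrix.mulVec_mulVec, Matrix.add_mulVec, Matrix.smul_mulVec, Matrix.one_mulVec]
  have h2 := dotProduct_mulVec_nonneg hA (regInv A l *ᵥ v)
  generalize regInv A l *ᵥ v = u at *
  rw [h, add_dotProduct, smul_dotProduct, smul_eq_mul, dotProduct_comm (A *ᵥ u)]
  linarith

theorem norm_regInv_le (hA : A.PosSemidef) (hl : 0 < l) : ‖regInv A l‖ ≤ 1 / l := by
  refine l2_opNorm_le_of_dotProduct_le (by positivity) fun v => ?_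
  have h : v = A *ᵥ (regInv A l *ᵥ v) + l • (regInv A l *ᵥ v) := by
    conv_lhs => rw [← Matrix.one_mulVec v, ← add_mul_regInv hA hl]
    rw [← Matrix.mulVec_mulVec, Matrix.add_mulVec, Matrix.smul_mulVec, Matrix.one_mulVec]
  have h2 := dotProduct_mulVec_nonneg hA (regInv A l *ᵥ v)
  have h5 : 0 ≤ (A *ᵥ (regInv A l *ᵥ v)) ⬝ᵥ (A *ᵥ (regInv A l *ᵥ v)) := by
    simpa using dotProduct_self_star_nonneg (A *ᵥ (regInv A l *ᵥ v))
  generalize regInv A l *ᵥ v = u at *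
  rw [h]
  simp only [add_dotProduct, dotProduct_add, smul_dotProduct, dotProduct_smul, smul_eq_mul,
    dotProduct_comm (A *ᵥ u) u]
  rw [div_pow, one_pow, div_mul_eq_mul_div, one_mul, le_div_iff₀ (by positivity)]
  nlinarith [mul_nonneg hl.le h2]

theorem norm_mul_regInv_le (hA : A.PosSemidef) (hl : 0 < l) : ‖A * regInv A l‖ ≤ 1 := by
  refine l2_opNorm_le_of_dotProduct_le zero_le_one fun v => ?_
  have h : v = A *ᵥ (regInv A l *ᵥ v) + l • (regInv A l *ᵥ v) := by
    conv_lhs => rw [← Matrix.one_mulVec v, ← add_mul_regInv hA hl]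
    rw [← Matrix.mulVec_mulVec, Matrix.add_mulVec, Matrix.smul_mulVec, Matrix.one_mulVec]
  have h2 := dotProduct_mulVec_nonneg hA (regInv A l *ᵥ v)
  have h5 : 0 ≤ (regInv A l *ᵥ v) ⬝ᵥ (regInv A l *ᵥ v) := by
    simpa using dotProduct_self_star_nonneg (regInv A l *ᵥ v)
  rw [← Matrix.mulVec_mulVec]
  generalize regInv A l *ᵥ v = u at *
  rw [h]
  simp only [add_dotProduct, dotProduct_add, smul_dotProduct, dotProduct_smul, smul_eq_mul,
    dotProduct_comm (A *ᵥ u) u]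
  nlinarith [mul_nonneg hl.le h2, mul_nonneg (mul_nonneg hl.le hl.le) h5]

theorem posSemidef_mul_regInv (hA : A.PosSemidef) (hl : 0 < l) : (A * regInv A l).PosSemidef := by
  have hV := posDef_regInv hA hl
  -- Inserting `V (A + l I) = 1` on the left displays the product as a sum of congruences of
  -- positive semidefinite matrices.
  have h : A * regInv A l = regInv A l * (A * Aᴴ) * (regInv A l)ᴴ
      + l • (regInv A l * A * (regInv A l)ᴴ) := by
    rw [hV.isHermitian, hA.isHermitian]
    calc A * regInv A l = (regInv A l * (A + l • 1)) * A * regInv A l := by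
          rw [regInv_mul_add hA hl, one_mul]
      _ = _ := by
          simp only [mul_add, add_mul, mul_smul_comm, smul_mul_assoc, mul_one, mul_assoc]
  rw [h]
  exact ((Matrix.posSemidef_self_mul_conjTranspose A).mul_mul_conjTranspose_same _).add
    ((hA.mul_mul_conjTranspose_same _).smul hl.le)

theorem regInv_sub_regInv (hA : A.PosSemidef) {a b : ℝ} (ha : 0 < a) (hb : 0 < b) :
    regInv A a - regInv A b = (b - a) • (regInv A a * regInv A b) := by
  have h : regInv A a * (A + b • 1) * regInv A b - regInv A a * (A + a • 1) * regInv A b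
      = (b - a) • (regInv A a * regInv A b) := by
    simp only [mul_add, add_mul, mul_smul_comm, smul_mul_assoc, mul_one, sub_smul]
    abel
  rwa [mul_assoc, add_mul_regInv hA hb, mul_one, regInv_mul_add hA ha, one_mul] at h

theorem trace_mul_regInv_anti (hS : S.PosSemidef) (hA : A.PosSemidef) {a b : ℝ} (ha : 0 < a)
    (hab : a ≤ b) : (S * regInv A b).trace ≤ (S * regInv A a).trace := by
  have hb := ha.trans_le hab
  have h : (regInv A a - regInv A b).PosSemidef := by
    -- The product of the two resolvents becomes a square plus a congruence, so it is visibly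
    -- positive semidefinite.
    have e : regInv A a * regInv A b =
        regInv A b * regInv A b + (b - a) • (regInv A b * regInv A a * (regInv A b)ᴴ) := by
      rw [(posDef_regInv hA hb).isHermitian]
      have h1 := regInv_sub_regInv hA hb ha
      have h2 : regInv A a = regInv A b + (b - a) • (regInv A b * regInv A a) := by
        rw [← neg_sub a b, neg_smul, ← h1]; abel
      conv_lhs => rw [h2]
      rw [add_mul, smul_mul_assoc]
    rw [regInv_sub_regInv hA ha hb, e]
    refine Matrix.PosSemidef.smul (Matrix.PosSemidef.add ?_ ?_) (sub_nonneg.2 hab)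
    · conv => arg 1; arg 2; rw [← (posDef_regInv hA hb).isHermitian]
      exact Matrix.posSemidef_self_mul_conjTranspose _
    · exact (((posDef_regInv hA ha).posSemidef).mul_mul_conjTranspose_same _).smul
        (sub_nonneg.2 hab)
  have := trace_mul_nonneg_of_posSemidef hS h
  rw [mul_sub, Matrix.trace_sub] at this
  linarith

/-- Adding a rank one matrix: action of the new regularized inverse on the added direction. -/
theorem regInv_add_vecMulVec_mulVec (hA : A.PosSemidef) (hl : 0 < l) {c : ℝ} (hc : 0 ≤ c)
    (x : Fin d → ℝ) :
    regInv (A + c • Matrix.vecMulVec x x) l *ᵥ x =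
      (1 + c * (x ⬝ᵥ (regInv A l *ᵥ x)))⁻¹ • (regInv A l *ᵥ x) := by
  have hx : (Matrix.vecMulVec x x).PosSemidef := by
    simpa using Matrix.posSemidef_vecMulVec_self_star x
  have hA' : (A + c • Matrix.vecMulVec x x).PosSemidef := hA.add (hx.smul hc)
  have hq : 0 < 1 + c * (x ⬝ᵥ (regInv A l *ᵥ x)) := by
    have := mul_nonneg hc (dotProduct_mulVec_nonneg (posDef_regInv hA hl).posSemidef x)
    linarith
  have h : (A + c • Matrix.vecMulVec x x + l • 1) *ᵥ (regInv A l *ᵥ x)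
      = (1 + c * (x ⬝ᵥ (regInv A l *ᵥ x))) • x := by
    rw [add_right_comm, Matrix.add_mulVec, Matrix.mulVec_mulVec, add_mul_regInv hA hl,
      Matrix.one_mulVec, Matrix.smul_mulVec, Matrix.vecMulVec_mulVec, add_smul, one_smul, mul_smul]
    congr 2
    ext i
    simp [mul_comm]
  rw [eq_inv_smul_iff₀ hq.ne', ← Matrix.mulVec_smul, ← h, Matrix.mulVec_mulVec,
    regInv_mul_add hA' hl, Matrix.one_mulVec]

/-- The bound is independent of the size of `x`. With `u = (A + l I)⁻¹ x` and `q = c xᵀu`, the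
resolvents differ by `c/(1 + q) u uᵀ`, and `l uᵀu ≤ xᵀu` gives `c uᵀu/(1 + q) ≤ q/(l (1 + q)) ≤
1/l`. -/
theorem abs_trace_mul_regInv_sub_le (hA : A.PosSemidef) (hl : 0 < l) {c : ℝ} (hc : 0 ≤ c)
    (x : Fin d → ℝ) (W : Matrix (Fin d) (Fin d) ℝ) :
    |(W * regInv A l).trace - (W * regInv (A + c • Matrix.vecMulVec x x) l).trace|
      ≤ ‖W‖ / l := by
  have hx : (Matrix.vecMulVec x x).PosSemidef := by
    simpa using Matrix.posSemidef_vecMulVec_self_star x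
  have hA' : (A + c • Matrix.vecMulVec x x).PosSemidef := hA.add (hx.smul hc)
  have hq0 := mul_nonneg hc (dotProduct_mulVec_nonneg (posDef_regInv hA hl).posSemidef x)
  set q := c * (x ⬝ᵥ (regInv A l *ᵥ x)) with hq
  set u := regInv A l *ᵥ x with hu
  have h1 : regInv A l - regInv (A + c • Matrix.vecMulVec x x) l
      = (c * (1 + q)⁻¹) • Matrix.vecMulVec u u := by
    have e : regInv (A + c • Matrix.vecMulVec x x) l * (A + c • Matrix.vecMulVec x x + l • 1)
        * regInv A l - regInv (A + c • Matrix.vecMulVec x x) l * (A + l • 1) * regInv A l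
        = c • (regInv (A + c • Matrix.vecMulVec x x) l * Matrix.vecMulVec x x * regInv A l) := by
      simp only [mul_add, add_mul, mul_smul_comm, smul_mul_assoc, mul_one]
      abel
    rw [regInv_mul_add hA' hl, one_mul, mul_assoc, add_mul_regInv hA hl, mul_one,
      Matrix.mul_vecMulVec, regInv_add_vecMulVec_mulVec hA hl hc, Matrix.vecMulVec_mul] at e
    rw [e, ← hq, ← hu, Matrix.smul_vecMulVec, smul_smul, ← Matrix.mulVec_transpose,
      regInv_transpose hA hl]
  rw [← Matrix.trace_sub, ← mul_sub, h1, mul_smul_comm, Matrix.trace_smul, Matrix.mul_vecMulVec,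
    Matrix.trace_vecMulVec, dotProduct_comm, smul_eq_mul, abs_mul,
    abs_of_nonneg (by positivity : 0 ≤ c * (1 + q)⁻¹), le_div_iff₀ hl]
  have h2 := abs_dotProduct_mulVec_le W u
  have h3 := dotProduct_regInv_mulVec_ge hA hl x
  rw [← hu] at h3
  calc c * (1 + q)⁻¹ * |u ⬝ᵥ W *ᵥ u| * l ≤ c * (1 + q)⁻¹ * (‖W‖ * (u ⬝ᵥ u)) * l := by gcongr
    _ = ‖W‖ * (1 + q)⁻¹ * (c * (l * (u ⬝ᵥ u))) := by ring
    _ ≤ ‖W‖ * (1 + q)⁻¹ * (c * (x ⬝ᵥ u)) := by gcongr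
    _ = ‖W‖ * (q / (1 + q)) := by rw [← hq]; ring
    _ ≤ ‖W‖ * 1 := by
        gcongr
        rw [div_le_one (by positivity)]
        linarith
    _ = ‖W‖ := mul_one _

end Resolvent

/-! ### Traces and norms in terms of eigenvalues. -/

section Spectral

variable {d : ℕ} {A : Matrix (Fin d) (Fin d) ℝ}

theorem trace_regInv_eq_sum (hA : A.IsHermitian) (hp : A.PosSemidef) {l : ℝ} (hl : 0 < l) :
    (regInv A l).trace = ∑ i, 1 / (hA.eigenvalues i + l) := by
  set U : Matrix (Fin d) (Fin d) ℝ := (hA.eigenvectorUnitary : Matrix (Fin d) (Fin d) ℝ) with hU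
  have hUU : star U * U = 1 := Unitary.coe_star_mul_self hA.eigenvectorUnitary
  have hUU' : U * star U = 1 := Unitary.coe_mul_star_self hA.eigenvectorUnitary
  have hs : A = U * Matrix.diagonal hA.eigenvalues * star U := by
    conv_lhs => rw [hA.spectral_theorem, Unitary.conjStarAlgAut_apply]
    rfl
  have hpos : ∀ i, 0 < hA.eigenvalues i + l := fun i =>
    add_pos_of_nonneg_of_pos (hp.eigenvalues_nonneg i) hl
  have h : regInv A l = U * Matrix.diagonal (fun i => 1 / (hA.eigenvalues i + l)) * star U := by
    refine Matrix.inv_eq_right_inv ?_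
    have e : A + l • 1 = U * Matrix.diagonal (fun i => hA.eigenvalues i + l) * star U := by
      have : Matrix.diagonal (fun i => hA.eigenvalues i + l)
          = Matrix.diagonal hA.eigenvalues + l • 1 := by
        ext i j
        by_cases hij : i = j <;> simp [hij, Matrix.diagonal]
      rw [this, mul_add, add_mul, ← hs, mul_smul_comm, mul_one, smul_mul_assoc, hUU']
    rw [e]
    calc _ = U * (Matrix.diagonal (fun i => hA.eigenvalues i + l) * (star U * U) *
          Matrix.diagonal (fun i => 1 / (hA.eigenvalues i + l))) * star U := by
          simp only [mul_assoc]
      _ = _ := by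
          rw [hUU, mul_one, Matrix.diagonal_mul_diagonal]
          have : (fun i => (hA.eigenvalues i + l) * (1 / (hA.eigenvalues i + l))) = fun _ => 1 := by
            funext i
            field_simp [(hpos i).ne']
          rw [this, Matrix.diagonal_one, mul_one, hUU']
  rw [h, Matrix.trace_mul_comm, ← mul_assoc, hUU, one_mul, Matrix.trace_diagonal]

theorem effDim_eq (hp : A.PosSemidef) {l : ℝ} (hl : 0 < l) :
    effDim A l = d - l * (regInv A l).trace := by
  rw [effDim, mul_regInv hp hl, Matrix.trace_sub, Matrix.trace_smul, Matrix.trace_one]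
  simp

theorem effDim_eq_sum (hA : A.IsHermitian) (hp : A.PosSemidef) {l : ℝ} (hl : 0 < l) :
    effDim A l = ∑ i, hA.eigenvalues i / (hA.eigenvalues i + l) := by
  rw [effDim_eq hp hl, trace_regInv_eq_sum hA hp hl, Finset.mul_sum]
  have : (d : ℝ) = ∑ _i : Fin d, (1 : ℝ) := by simp
  rw [this, ← Finset.sum_sub_distrib]
  refine Finset.sum_congr rfl fun i _ => ?_
  have := add_pos_of_nonneg_of_pos (hp.eigenvalues_nonneg i) hl
  field_simp
  ring

theorem norm_le_of_eigenvalues_le (hA : A.IsHermitian) {a : ℝ} (ha : 0 ≤ a)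
    (h : ∀ i, |hA.eigenvalues i| ≤ a) : ‖A‖ ≤ a := by
  conv_lhs => rw [hA.spectral_theorem, Unitary.conjStarAlgAut_apply]
  rw [← Unitary.coe_star, CStarRing.norm_mul_coe_unitary, CStarRing.norm_coe_unitary_mul, Matrix.l2_opNorm_diagonal]
  exact (pi_norm_le_iff_of_nonneg ha).2 fun i => by simpa using h i

end Spectral

end NaiveAveraging

namespace NaiveAveraging

/-! ### The deterministic leave-one-out estimate. -/

section LeaveOneOut

variable {n d : ℕ}

/-- The contribution to the empirical covariance of all sample points but the `i`-th. -/
noncomputable def leaveOneOut (x : Fin n → EuclideanSpace ℝ (Fin d)) (i : Fin n) :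
    Matrix (Fin d) (Fin d) ℝ :=
  (n : ℝ)⁻¹ • ∑ j ∈ Finset.univ.erase i, Matrix.vecMulVec (x j).ofLp (x j).ofLp

theorem posSemidef_sum_vecMulVec (x : Fin n → EuclideanSpace ℝ (Fin d)) (s : Finset (Fin n)) :
    ((n : ℝ)⁻¹ • ∑ j ∈ s, Matrix.vecMulVec (x j).ofLp (x j).ofLp).PosSemidef := by
  refine Matrix.PosSemidef.smul (Matrix.posSemidef_sum _ fun i _ => ?_) (by positivity)
  simpa using Matrix.posSemidef_vecMulVec_self_star (x i).ofLp

theorem posSemidef_sampleCov (x : Fin n → EuclideanSpace ℝ (Fin d)) : (sampleCov x).PosSemidef :=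
  posSemidef_sum_vecMulVec x Finset.univ

theorem posSemidef_leaveOneOut (x : Fin n → EuclideanSpace ℝ (Fin d)) (i : Fin n) :
    (leaveOneOut x i).PosSemidef :=
  posSemidef_sum_vecMulVec x _

theorem leaveOneOut_add (x : Fin n → EuclideanSpace ℝ (Fin d)) (i : Fin n) :
    leaveOneOut x i + (n : ℝ)⁻¹ • Matrix.vecMulVec (x i).ofLp (x i).ofLp = sampleCov x := by
  rw [leaveOneOut, sampleCov, ← smul_add, Finset.sum_erase_add _ _ (Finset.mem_univ i)]

/-- This is the form in which independence is used: integrating over the `i`-th sample point leaves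
the matrix in its quadratic form fixed. -/
theorem leaveOneOut_update (x : Fin n → EuclideanSpace ℝ (Fin d)) (i : Fin n)
    (z : EuclideanSpace ℝ (Fin d)) :
    leaveOneOut (Function.update x i z) i = leaveOneOut x i := by
  rw [leaveOneOut, leaveOneOut]
  congr 1
  refine Finset.sum_congr rfl fun j hj => ?_
  rw [Function.update_of_ne (Finset.ne_of_mem_erase hj)]

/-- The deviation of the quadratic form of the `i`-th sample point from its conditional mean. -/
noncomputable def quadDev (S B : Matrix (Fin d) (Fin d) ℝ) (z : EuclideanSpace ℝ (Fin d)) : ℝ :=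
  |z.ofLp ⬝ᵥ (B *ᵥ z.ofLp) - (S * B).trace|

/-- The self-consistent equation for `tr (S R) / n` holds up to deviations of quadratic forms. -/
theorem abs_trace_sub_le {S : Matrix (Fin d) (Fin d) ℝ} (hS : S.PosSemidef) (hn : 0 < n)
    (x : Fin n → EuclideanSpace ℝ (Fin d)) {l k : ℝ} (hl : 0 < l) (hk : 0 ≤ k) :
    |(n : ℝ)⁻¹ * (S * regInv (sampleCov x) l).trace - k| ≤
      (1 + S.trace / (n * l)) * (|(1 + k) * ((n : ℝ)⁻¹ * effDim S (l * (1 + k))) - k| +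
        (1 + k) * ((n : ℝ)⁻¹ * ∑ i,
          ((n : ℝ)⁻¹ * quadDev S (regInv (leaveOneOut x i) l * (S * regInv S (l * (1 + k)))) (x i)
            + (n : ℝ)⁻¹ * quadDev S (regInv (leaveOneOut x i) l) (x i)
            + 2 * ‖S‖ / (l * n)))) := by
  have hn' : (0 : ℝ) < n := Nat.cast_pos.2 hn
  set m := l * (1 + k) with hm
  have hmpos : 0 < m := by positivity
  set R := regInv (sampleCov x) l with hR
  set V := regInv S m with hV
  set C := S * V with hC
  set κ := (n : ℝ)⁻¹ * (S * R).trace with hκ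
  set τ := (n : ℝ)⁻¹ * (C * S * R).trace with hτ
  have hRpd : R.PosDef := posDef_regInv (posSemidef_sampleCov x) hl
  have hCS : (C * S).PosSemidef := by
    have := (posDef_regInv hS hmpos).posSemidef.mul_mul_conjTranspose_same S
    rwa [hS.isHermitian] at this
  have hτ0 : 0 ≤ τ := mul_nonneg (by positivity)
    (trace_mul_nonneg_of_posSemidef hCS hRpd.posSemidef)
  -- Here `S - C S = m S V` is positive semidefinite. The inequality `τ ≤ κ` is what later makes the
  -- equation for `κ - k` stable.
  have hτκ : τ ≤ κ := by
    have h1 : S - C * S = m • (S * V) := by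
      rw [hC, mul_assoc, hV, regInv_mul hS hmpos, mul_sub, mul_one, mul_smul_comm, sub_sub_cancel]
    have h2 : 0 ≤ ((S - C * S) * R).trace := by
      rw [h1]
      exact trace_mul_nonneg_of_posSemidef ((posSemidef_mul_regInv hS hmpos).smul hmpos.le)
        hRpd.posSemidef
    rw [sub_mul, Matrix.trace_sub] at h2
    exact mul_le_mul_of_nonneg_left (by linarith) (by positivity)
  have hκ1 : 1 + κ ≤ 1 + S.trace / (n * l) := by
    have h1 := (le_abs_self _).trans (abs_trace_mul_le hS R)
    have h2 := norm_regInv_le (posSemidef_sampleCov x) hl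
    have h3 : (S * R).trace ≤ 1 / l * S.trace :=
      h1.trans (mul_le_mul_of_nonneg_right h2 hS.trace_nonneg)
    have : κ ≤ (n : ℝ)⁻¹ * (1 / l * S.trace) := mul_le_mul_of_nonneg_left h3 (by positivity)
    have e : (n : ℝ)⁻¹ * (1 / l * S.trace) = S.trace / (n * l) := by field_simp
    linarith
  have hCnorm : ‖C‖ ≤ 1 := norm_mul_regInv_le hS hmpos
  have hCSnorm : ‖C * S‖ ≤ ‖S‖ := (norm_mul_le _ _).trans (by nlinarith [norm_nonneg S])
  -- the resolvent identity
  have hid : κ - (1 + k) * ((n : ℝ)⁻¹ * effDim S m) =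
      τ - (1 + k) * ((n : ℝ)⁻¹ * ∑ i, (n : ℝ)⁻¹ * ((x i).ofLp ⬝ᵥ ((R * C) *ᵥ (x i).ofLp))) := by
    -- Multiply `(1 + k)(Σ̂ + l I)` and `S + m I` by `V` on the left and `R` on the right; the
    -- choice `m = l (1 + k)` cancels the multiples of `V R`.
    have h1 : R - (1 + k) • V = V * S * R - (1 + k) • (V * sampleCov x * R) := by
      have e1 : V * (S + m • 1) * R = R := by rw [regInv_mul_add hS hmpos, one_mul]
      have e2 : V * (sampleCov x + l • 1) * R = V := by
        rw [mul_assoc, add_mul_regInv (posSemidef_sampleCov x) hl, mul_one]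
      conv_lhs => rw [← e2]
      nth_rw 1 [← e1]
      simp only [mul_add, add_mul, mul_smul_comm, smul_mul_assoc, mul_one, smul_add, smul_smul]
      rw [show 1 * l + k * l = m by rw [hm]; ring]
      abel
    have h2 := congrArg (fun M => (S * M).trace) h1
    simp only [mul_sub, Matrix.trace_sub, mul_smul_comm, Matrix.trace_smul, smul_eq_mul] at h2
    have h3 : (S * (V * sampleCov x * R)).trace
        = ∑ i, (n : ℝ)⁻¹ * ((x i).ofLp ⬝ᵥ ((R * C) *ᵥ (x i).ofLp)) := by
      have e : S * (V * sampleCov x * R) = C * sampleCov x * R := by simp only [hC, mul_assoc]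
      rw [e, Matrix.trace_mul_comm, ← mul_assoc, sampleCov, mul_smul_comm, Matrix.trace_smul,
        Finset.mul_sum, Matrix.trace_sum, smul_eq_mul, Finset.mul_sum]
      refine Finset.sum_congr rfl fun i _ => ?_
      rw [Matrix.mul_vecMulVec, Matrix.trace_vecMulVec, dotProduct_comm]
    have h4 : S * (V * S * R) = C * S * R := by simp only [hC, mul_assoc]
    rw [h3, h4] at h2
    rw [hκ, hτ, effDim, ← hV]
    linear_combination (n : ℝ)⁻¹ * h2
  -- one summand of the error
  have hterm : ∀ i, |(n : ℝ)⁻¹ * ((x i).ofLp ⬝ᵥ ((R * C) *ᵥ (x i).ofLp)) - τ / (1 + κ)| ≤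
      (n : ℝ)⁻¹ * quadDev S (regInv (leaveOneOut x i) l * C) (x i)
            + (n : ℝ)⁻¹ * quadDev S (regInv (leaveOneOut x i) l) (x i)
            + 2 * ‖S‖ / (l * n) := by
    intro i
    have hG := posSemidef_leaveOneOut x i
    set Q := regInv (leaveOneOut x i) l with hQ
    have hQpd : Q.PosDef := posDef_regInv hG hl
    set q := (n : ℝ)⁻¹ * ((x i).ofLp ⬝ᵥ (Q *ᵥ (x i).ofLp)) with hq
    set T := (n : ℝ)⁻¹ * ((x i).ofLp ⬝ᵥ ((Q * C) *ᵥ (x i).ofLp)) with hT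
    have hq0 : 0 ≤ q := mul_nonneg (by positivity) (dotProduct_mulVec_nonneg hQpd.posSemidef _)
    have hRi : R = regInv (leaveOneOut x i + (n : ℝ)⁻¹ • Matrix.vecMulVec (x i).ofLp (x i).ofLp) l
        := by rw [leaveOneOut_add]
    have h1 : (n : ℝ)⁻¹ * ((x i).ofLp ⬝ᵥ ((R * C) *ᵥ (x i).ofLp)) = T / (1 + q) := by
      have e1 : ∀ M : Matrix (Fin d) (Fin d) ℝ, Mᵀ = M →
          (x i).ofLp ⬝ᵥ ((M * C) *ᵥ (x i).ofLp) = (M *ᵥ (x i).ofLp) ⬝ᵥ (C *ᵥ (x i).ofLp) := by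
        intro M hM
        rw [← Matrix.mulVec_mulVec, Matrix.dotProduct_mulVec, ← Matrix.mulVec_transpose, hM]
      rw [hT, e1 R (regInv_transpose (posSemidef_sampleCov x) hl), e1 Q (regInv_transpose hG hl),
        hRi, regInv_add_vecMulVec_mulVec hG hl (by positivity), ← hQ, ← hq, smul_dotProduct,
        smul_eq_mul]
      ring
    -- Two replacements: the quadratic form by its conditional mean `tr (S Q C)`, then `Q` by `R`
    -- through the rank one bound. The estimate for `q` and `κ` is the same with `C` replaced by the
    -- identity.
    have h2 : |T - τ| ≤ (n : ℝ)⁻¹ * quadDev S (Q * C) (x i) + ‖S‖ / (l * n) := by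
      have e := abs_trace_mul_regInv_sub_le hG hl (inv_nonneg.2 hn'.le) (x i).ofLp (C * S)
      rw [← hRi, ← hQ] at e
      have e2 : (C * S * Q).trace = (S * (Q * C)).trace := by
        rw [mul_assoc, Matrix.trace_mul_comm, mul_assoc]
      rw [e2] at e
      have e3 : T - τ = (n : ℝ)⁻¹ * ((x i).ofLp ⬝ᵥ ((Q * C) *ᵥ (x i).ofLp) - (S * (Q * C)).trace)
          + (n : ℝ)⁻¹ * ((S * (Q * C)).trace - (C * S * R).trace) := by
        rw [hT, hτ]; ring
      rw [e3]
      refine (abs_add_le _ _).trans ?_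
      rw [abs_mul, abs_mul, abs_of_nonneg (inv_nonneg.2 hn'.le)]
      refine add_le_add le_rfl ?_
      calc _ ≤ (n : ℝ)⁻¹ * (‖C * S‖ / l) := by gcongr
        _ ≤ (n : ℝ)⁻¹ * (‖S‖ / l) := by gcongr
        _ = _ := by field_simp
    have h3 : |κ - q| ≤ (n : ℝ)⁻¹ * quadDev S Q (x i) + ‖S‖ / (l * n) := by
      have e := abs_trace_mul_regInv_sub_le hG hl (inv_nonneg.2 hn'.le) (x i).ofLp S
      rw [← hRi, ← hQ] at e
      have e3 : q - κ = (n : ℝ)⁻¹ * ((x i).ofLp ⬝ᵥ (Q *ᵥ (x i).ofLp) - (S * Q).trace)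
          + (n : ℝ)⁻¹ * ((S * Q).trace - (S * R).trace) := by
        rw [hκ, hq]; ring
      rw [abs_sub_comm, e3]
      refine (abs_add_le _ _).trans ?_
      rw [abs_mul, abs_mul, abs_of_nonneg (inv_nonneg.2 hn'.le)]
      refine add_le_add le_rfl ?_
      calc _ ≤ (n : ℝ)⁻¹ * (‖S‖ / l) := by gcongr
        _ = _ := by field_simp
    have hκ0 : 0 ≤ κ := hτ0.trans hτκ
    have h4 : T / (1 + q) - τ / (1 + κ) = (T - τ) / (1 + q)
        + (κ - q) * ((τ / (1 + κ)) / (1 + q)) := by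
      field_simp
      ring
    rw [h1, h4]
    refine (abs_add_le _ _).trans ?_
    rw [abs_div, abs_mul, abs_of_pos (by positivity : 0 < 1 + q),
      abs_of_nonneg (by positivity : 0 ≤ (τ / (1 + κ)) / (1 + q))]
    have h5 : |T - τ| / (1 + q) ≤ |T - τ| := div_le_self (abs_nonneg _) (by linarith)
    have h6 : (τ / (1 + κ)) / (1 + q) ≤ 1 := by
      refine (div_le_self (by positivity) (by linarith)).trans ?_
      rw [div_le_one (by positivity)]
      linarith
    have h7 : |κ - q| * ((τ / (1 + κ)) / (1 + q)) ≤ |κ - q| :=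
      mul_le_of_le_one_right (abs_nonneg _) h6
    have h8 : 2 * ‖S‖ / (l * n) = ‖S‖ / (l * n) + ‖S‖ / (l * n) := by ring
    linarith
  have hsum : |(n : ℝ)⁻¹ * ∑ i, (n : ℝ)⁻¹ * ((x i).ofLp ⬝ᵥ ((R * C) *ᵥ (x i).ofLp)) - τ / (1 + κ)|
      ≤ (n : ℝ)⁻¹ * ∑ i, ((n : ℝ)⁻¹ * quadDev S (regInv (leaveOneOut x i) l * C) (x i)
            + (n : ℝ)⁻¹ * quadDev S (regInv (leaveOneOut x i) l) (x i)
            + 2 * ‖S‖ / (l * n)) := by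
    have e : (n : ℝ)⁻¹ * ∑ i, (n : ℝ)⁻¹ * ((x i).ofLp ⬝ᵥ ((R * C) *ᵥ (x i).ofLp)) - τ / (1 + κ)
        = (n : ℝ)⁻¹ *
          ∑ i, ((n : ℝ)⁻¹ * ((x i).ofLp ⬝ᵥ ((R * C) *ᵥ (x i).ofLp)) - τ / (1 + κ)) := by
      rw [Finset.sum_sub_distrib, Finset.sum_const, Finset.card_univ, Fintype.card_fin,
        nsmul_eq_mul, mul_sub, inv_mul_cancel_left₀ hn'.ne']
    rw [e, abs_mul, abs_of_nonneg (inv_nonneg.2 hn'.le)]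
    refine mul_le_mul_of_nonneg_left ?_ (by positivity)
    exact (Finset.abs_sum_le_sum_abs _ _).trans (Finset.sum_le_sum fun i _ => hterm i)
  set E := (n : ℝ)⁻¹ * ∑ i, ((n : ℝ)⁻¹ * quadDev S (regInv (leaveOneOut x i) l * C) (x i)
            + (n : ℝ)⁻¹ * quadDev S (regInv (leaveOneOut x i) l) (x i)
            + 2 * ‖S‖ / (l * n)) with hE
  set Z := (n : ℝ)⁻¹ * ∑ i, (n : ℝ)⁻¹ * ((x i).ofLp ⬝ᵥ ((R * C) *ᵥ (x i).ofLp)) with hZ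
  set e := (1 + k) * ((n : ℝ)⁻¹ * effDim S m) - k with he
  have hκ0 : 0 ≤ κ := hτ0.trans hτκ
  have hE0 : 0 ≤ E := (abs_nonneg _).trans hsum
  -- Writing `τ = (1 + κ) · τ/(1 + κ)` gives `τ - (1 + k) τ/(1 + κ) = (κ - k) τ/(1 + κ)`, which
  -- moves to the left-hand side.
  have key : (κ - k) * (1 - τ / (1 + κ)) = e - (1 + k) * (Z - τ / (1 + κ)) := by
    have h0 : (1 + κ) * (τ / (1 + κ)) = τ := by field_simp
    linear_combination hid - h0
  -- The product equals `1 + κ - τ`, so dividing by the coefficient costs at most a factor `1 + κ`,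
  -- and `κ` has an a priori bound.
  have hfac : 1 ≤ (1 + κ) * (1 - τ / (1 + κ)) := by
    have h0 : (1 + κ) * (τ / (1 + κ)) = τ := by field_simp
    nlinarith
  have hfac0 : 0 ≤ 1 - τ / (1 + κ) := by
    rw [sub_nonneg, div_le_one (by positivity)]
    linarith
  have hb : |(κ - k) * (1 - τ / (1 + κ))| ≤ |e| + (1 + k) * E := by
    rw [key]
    refine (abs_sub _ _).trans ?_
    rw [abs_mul, abs_of_nonneg (by positivity : 0 ≤ 1 + k)]
    gcongr
  rw [abs_mul, abs_of_nonneg hfac0] at hb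
  calc |κ - k| = |κ - k| * 1 := (mul_one _).symm
    _ ≤ |κ - k| * ((1 + κ) * (1 - τ / (1 + κ))) := by gcongr
    _ = (1 + κ) * (|κ - k| * (1 - τ / (1 + κ))) := by ring
    _ ≤ (1 + κ) * (|e| + (1 + k) * E) := by gcongr
    _ ≤ _ := by gcongr

end LeaveOneOut

end NaiveAveraging

namespace NaiveAveraging

/-! ### Mean and concentration of quadratic forms of one sample point. -/

section QuadraticForms

variable {d : ℕ} {D : Measure (EuclideanSpace ℝ (Fin d))} [IsProbabilityMeasure D]

theorem memLp_eval_of_fourthMoment_lt_top (h4 : fourthMoment D < ∞) (i : Fin d) :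
    MemLp (fun x : EuclideanSpace ℝ (Fin d) => x i) 2 D := by
  have hm : AEStronglyMeasurable (fun x : EuclideanSpace ℝ (Fin d) => x i) D :=
    Continuous.aestronglyMeasurable (by fun_prop)
  have h : MemLp (fun x : EuclideanSpace ℝ (Fin d) => x i) 4 D := by
    refine ⟨hm, ?_⟩
    rw [eLpNorm_lt_top_iff_lintegral_rpow_enorm_lt_top (by norm_num) (by norm_num)]
    refine lt_of_le_of_lt ?_ h4
    refine le_trans (le_of_eq ?_) (le_iSup₂ (f := fun (e : EuclideanSpace ℝ (Fin d))
      (_ : ‖e‖ = 1) => ∫⁻ x, ENNReal.ofReal ((inner ℝ e x) ^ 4) ∂D)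
      (EuclideanSpace.single i (1 : ℝ)) (by simp))
    refine lintegral_congr fun x => ?_
    rw [EuclideanSpace.inner_single_left]
    simp only [map_one, one_mul]
    rw [show ((4 : ℝ≥0∞).toReal) = ((4 : ℕ) : ℝ) by norm_num, ENNReal.rpow_natCast,
      ← Even.pow_abs (by decide : Even 4), ENNReal.ofReal_pow (abs_nonneg _),
      Real.enorm_eq_ofReal_abs]
  exact h.mono_exponent (by norm_num)

theorem integral_eval_eq_zero (h4 : fourthMoment D < ∞) (hmean : ∫ x, x ∂D = 0) (i : Fin d) :
    ∫ x : EuclideanSpace ℝ (Fin d), x i ∂D = 0 := by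
  rw [← eval_integral_piLp (f := fun x : EuclideanSpace ℝ (Fin d) => x)
    (fun j => (memLp_eval_of_fourthMoment_lt_top h4 j).integrable (by norm_num)), hmean]
  rfl

theorem integral_dotProduct_mulVec (h4 : fourthMoment D < ∞) (hmean : ∫ x, x ∂D = 0)
    (B : Matrix (Fin d) (Fin d) ℝ) :
    ∫ x : EuclideanSpace ℝ (Fin d), x.ofLp ⬝ᵥ (B *ᵥ x.ofLp) ∂D = (covMatrix D * B).trace := by
  have hint : ∀ i j, Integrable (fun x : EuclideanSpace ℝ (Fin d) => x i * (B i j * x j)) D := by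
    intro i j
    have := ((memLp_eval_of_fourthMoment_lt_top h4 i).integrable_mul
      (memLp_eval_of_fourthMoment_lt_top h4 j)).const_mul (B i j)
    refine this.congr (ae_of_all _ fun x => ?_)
    simp only [Pi.mul_apply]
    ring
  have e : ∀ x : EuclideanSpace ℝ (Fin d),
      x.ofLp ⬝ᵥ (B *ᵥ x.ofLp) = ∑ i, ∑ j, x i * (B i j * x j) := by
    intro x
    simp only [dotProduct, Matrix.mulVec, Finset.mul_sum]
  simp_rw [e]
  rw [integral_finsetSum _ fun i _ => integrable_finsetSum _ fun j _ => hint i j]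
  simp_rw [integral_finsetSum _ fun j _ => hint _ j]
  rw [Finset.sum_comm, Matrix.trace]
  refine Finset.sum_congr rfl fun j _ => ?_
  rw [Matrix.diag_apply, Matrix.mul_apply]
  refine Finset.sum_congr rfl fun i _ => ?_
  rw [covMatrix, Matrix.of_apply, covariance, integral_eval_eq_zero h4 hmean,
    integral_eval_eq_zero h4 hmean, ← integral_mul_const]
  refine integral_congr_ae (ae_of_all _ fun x => ?_)
  simp only [sub_zero]
  ring

theorem evariance_quadForm_le (hd : 0 < d) (B : Matrix (Fin d) (Fin d) ℝ) :
    evariance (fun x : EuclideanSpace ℝ (Fin d) => x.ofLp ⬝ᵥ (B *ᵥ x.ofLp)) D ≤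
      ENNReal.ofReal ((d * ‖B‖) ^ 2) * quadVar D := by
  -- The supremum runs over matrices of norm one, so `B` has to be normalized and `0` treated apart.
  rcases eq_or_ne B 0 with rfl | hB
  · simp [Matrix.zero_mulVec, evariance]
  have hB' : 0 < ‖B‖ := norm_pos_iff.2 hB
  have hd' : (0 : ℝ) < d := Nat.cast_pos.2 hd
  have h : evariance (fun x : EuclideanSpace ℝ (Fin d) =>
      (x.ofLp ⬝ᵥ ((‖B‖⁻¹ • B) *ᵥ x.ofLp)) / (d : ℝ)) D ≤ quadVar D :=
    le_iSup₂ (f := fun (B : Matrix (Fin d) (Fin d) ℝ) (_ : ‖B‖ = 1) =>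
      evariance (fun x : EuclideanSpace ℝ (Fin d) => (x.ofLp ⬝ᵥ (B *ᵥ x.ofLp)) / (d : ℝ)) D)
      (‖B‖⁻¹ • B) (by rw [norm_smul, norm_inv, norm_norm, inv_mul_cancel₀ hB'.ne'])
  have e : (fun x : EuclideanSpace ℝ (Fin d) => x.ofLp ⬝ᵥ (B *ᵥ x.ofLp)) =
      fun x => (d * ‖B‖) * ((x.ofLp ⬝ᵥ ((‖B‖⁻¹ • B) *ᵥ x.ofLp)) / (d : ℝ)) := by
    funext x
    rw [Matrix.smul_mulVec, dotProduct_smul, smul_eq_mul]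
    field_simp
  rw [e, evariance_mul]
  gcongr

/-- The trace is the mean of the quadratic form, so the first absolute moment of the deviation is at
most the standard deviation, which `quadVar` controls after scaling. -/
theorem lintegral_quadDev_le (h4 : fourthMoment D < ∞) (hmean : ∫ x, x ∂D = 0)
    (hq : quadVar D < ∞) (hd : 0 < d) (B : Matrix (Fin d) (Fin d) ℝ) {b : ℝ} (hb : ‖B‖ ≤ b) :
    ∫⁻ x, ENNReal.ofReal (quadDev (covMatrix D) B x) ∂D ≤
      ENNReal.ofReal (d * b * √(quadVar D).toReal) := by
  set g : EuclideanSpace ℝ (Fin d) → ℝ :=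
    fun x => x.ofLp ⬝ᵥ (B *ᵥ x.ofLp) - (covMatrix D * B).trace with hg
  have hgm : AEStronglyMeasurable g D :=
    Continuous.aestronglyMeasurable (by
      simp only [hg, dotProduct, Matrix.mulVec]
      fun_prop)
  have h1 : ∫⁻ x, ENNReal.ofReal (quadDev (covMatrix D) B x) ∂D = eLpNorm g 1 D := by
    rw [eLpNorm_one_eq_lintegral_enorm]
    exact lintegral_congr fun x => (Real.enorm_eq_ofReal_abs _).symm
  have h2 : eLpNorm g 2 D =
      (evariance (fun x : EuclideanSpace ℝ (Fin d) => x.ofLp ⬝ᵥ (B *ᵥ x.ofLp)) D) ^ (1 / 2 : ℝ) := by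
    rw [eLpNorm_eq_lintegral_rpow_enorm_toReal (by norm_num) (by norm_num), evariance,
      integral_dotProduct_mulVec h4 hmean]
    norm_num
    rfl
  rw [h1]
  refine (eLpNorm_le_eLpNorm_of_exponent_le (by norm_num : (1 : ℝ≥0∞) ≤ 2) hgm).trans ?_
  rw [h2]
  have hb0 : 0 ≤ b := (norm_nonneg _).trans hb
  have h3 : evariance (fun x : EuclideanSpace ℝ (Fin d) => x.ofLp ⬝ᵥ (B *ᵥ x.ofLp)) D ≤
      ENNReal.ofReal ((d * b * √(quadVar D).toReal) ^ 2) := by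
    refine (evariance_quadForm_le hd B).trans ?_
    rw [mul_pow (_ * _), Real.sq_sqrt ENNReal.toReal_nonneg, ENNReal.ofReal_mul (by positivity),
      ENNReal.ofReal_toReal hq.ne]
    gcongr
  calc _ ≤ (ENNReal.ofReal ((d * b * √(quadVar D).toReal) ^ 2)) ^ (1 / 2 : ℝ) := by gcongr
    _ = _ := by
      rw [ENNReal.ofReal_rpow_of_nonneg (by positivity) (by norm_num), ← Real.sqrt_eq_rpow,
        Real.sqrt_sq (by positivity)]

end QuadraticForms

/-! ### Averaging the leave-one-out estimate over independent samples. -/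

section ProductMeasure

variable {n d : ℕ}

/-- Tonelli with the `i`-th coordinate integrated first: a uniform bound on the conditional integral
passes to the full one, as the measure is a probability. -/
theorem lintegral_pi_le_of_update {α : Type*} [MeasurableSpace α] {D : Measure α}
    [IsProbabilityMeasure D] [Nonempty α] {f : (Fin n → α) → ℝ≥0∞} (hf : Measurable f) (i : Fin n)
    {c : ℝ≥0∞} (h : ∀ x, ∫⁻ z, f (Function.update x i z) ∂D ≤ c) :
    ∫⁻ x, f x ∂(Measure.pi fun _ => D) ≤ c := by
  inhabit α
  rw [lintegral_eq_lmarginal_univ (fun _ => default), lmarginal_erase' _ hf (Finset.mem_univ i)]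
  refine (lmarginal_mono (g := fun _ => c) (fun x => h x) _).trans ?_
  simp [lmarginal]

theorem continuous_regInv {α : Type*} [TopologicalSpace α] {A : α → Matrix (Fin d) (Fin d) ℝ}
    (hA : Continuous A) (hp : ∀ a, (A a).PosSemidef) {l : ℝ} (hl : 0 < l) :
    Continuous fun a => regInv (A a) l := by
  have h : ∀ a, regInv (A a) l = (A a + l • (1 : Matrix (Fin d) (Fin d) ℝ)).det⁻¹ •
      (A a + l • (1 : Matrix (Fin d) (Fin d) ℝ)).adjugate := fun a => by
    rw [regInv, Matrix.inv_def, Ring.inverse_eq_inv']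
  have hc : Continuous fun a => A a + l • (1 : Matrix (Fin d) (Fin d) ℝ) := by fun_prop
  simp_rw [h]
  exact (hc.matrix_det.inv₀ fun a => (isUnit_det_add_smul_one (hp a) hl).ne_zero).smul
    hc.matrix_adjugate

theorem continuous_sum_vecMulVec (s : Finset (Fin n)) :
    Continuous fun x : Fin n → EuclideanSpace ℝ (Fin d) =>
      (n : ℝ)⁻¹ • ∑ j ∈ s, Matrix.vecMulVec (x j).ofLp (x j).ofLp := by
  have h : ∀ j, Continuous fun x : Fin n → EuclideanSpace ℝ (Fin d) =>
      Matrix.vecMulVec (x j).ofLp (x j).ofLp := fun j => by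
    have : Continuous fun x : Fin n → EuclideanSpace ℝ (Fin d) => (x j).ofLp :=
      (PiLp.continuous_ofLp 2 _).comp (continuous_apply j)
    exact this.matrix_vecMulVec this
  have h2 := continuous_finsetSum s fun j _ => h j
  exact h2.const_smul ((n : ℝ)⁻¹)

theorem continuous_regInv_sampleCov {l : ℝ} (hl : 0 < l) :
    Continuous fun x : Fin n → EuclideanSpace ℝ (Fin d) => regInv (sampleCov x) l :=
  continuous_regInv (continuous_sum_vecMulVec _) posSemidef_sampleCov hl

theorem continuous_regInv_leaveOneOut {l : ℝ} (hl : 0 < l) (i : Fin n) :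
    Continuous fun x : Fin n → EuclideanSpace ℝ (Fin d) => regInv (leaveOneOut x i) l :=
  continuous_regInv (continuous_sum_vecMulVec _) (fun x => posSemidef_leaveOneOut x i) hl

theorem continuous_quadDev (S : Matrix (Fin d) (Fin d) ℝ) {α : Type*} [TopologicalSpace α]
    {B : α → Matrix (Fin d) (Fin d) ℝ} (hB : Continuous B) {z : α → EuclideanSpace ℝ (Fin d)}
    (hz : Continuous z) : Continuous fun a => quadDev S (B a) (z a) := by
  have hz' : Continuous fun a => (z a).ofLp := (PiLp.continuous_ofLp 2 _).comp hz
  exact ((hz'.dotProduct (hB.matrix_mulVec hz')).sub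
    (continuous_const.matrix_mul hB).matrix_trace).abs

theorem integrable_and_integral_le_of_lintegral_le {α : Type*} [MeasurableSpace α]
    {μ : Measure α} {f : α → ℝ} (hf : AEStronglyMeasurable f μ) (h0 : ∀ a, 0 ≤ f a) {c : ℝ}
    (hc : 0 ≤ c) (h : ∫⁻ a, ENNReal.ofReal (f a) ∂μ ≤ ENNReal.ofReal c) :
    Integrable f μ ∧ ∫ a, f a ∂μ ≤ c := by
  refine ⟨⟨hf, ?_⟩, ?_⟩
  · rw [hasFiniteIntegral_iff_ofReal (ae_of_all _ h0)]
    exact h.trans_lt ENNReal.ofReal_lt_top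
  · rw [integral_eq_lintegral_of_nonneg_ae (ae_of_all _ h0) hf]
    exact (ENNReal.toReal_mono ENNReal.ofReal_ne_top h).trans (ENNReal.toReal_ofReal hc).le

variable {D : Measure (EuclideanSpace ℝ (Fin d))} [IsProbabilityMeasure D]

/-- With the other points frozen, the matrix is constant of norm at most `1/l`, so the one-point
bound applies uniformly. The factor `C` serves both `C = S (S + m I)⁻¹` and `C = 1`. -/
theorem integral_quadDev_leaveOneOut_le (h4 : fourthMoment D < ∞) (hmean : ∫ x, x ∂D = 0)
    (hq : quadVar D < ∞) (hd : 0 < d) {l : ℝ} (hl : 0 < l) (C : Matrix (Fin d) (Fin d) ℝ)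
    (hC : ‖C‖ ≤ 1) (i : Fin n) :
    Integrable (fun x : Fin n → EuclideanSpace ℝ (Fin d) =>
        quadDev (covMatrix D) (regInv (leaveOneOut x i) l * C) (x i)) (Measure.pi fun _ => D) ∧
      ∫ x : Fin n → EuclideanSpace ℝ (Fin d),
        quadDev (covMatrix D) (regInv (leaveOneOut x i) l * C) (x i) ∂(Measure.pi fun _ => D) ≤
        d * (1 / l) * √(quadVar D).toReal := by
  have hc : Continuous fun x : Fin n → EuclideanSpace ℝ (Fin d) =>
      quadDev (covMatrix D) (regInv (leaveOneOut x i) l * C) (x i) :=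
    continuous_quadDev _ ((continuous_regInv_leaveOneOut hl i).matrix_mul continuous_const)
      (continuous_apply i)
  refine integrable_and_integral_le_of_lintegral_le hc.aestronglyMeasurable
    (fun _ => abs_nonneg _) (by positivity) ?_
  refine lintegral_pi_le_of_update hc.measurable.ennreal_ofReal i fun x => ?_
  simp_rw [leaveOneOut_update, Function.update_self]
  refine lintegral_quadDev_le h4 hmean hq hd _ ((norm_mul_le _ _).trans ?_)
  have := norm_regInv_le (posSemidef_leaveOneOut x i) hl
  nlinarith [norm_nonneg (regInv (leaveOneOut x i) l), norm_nonneg C]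

theorem integrable_regInv_sampleCov {l : ℝ} (hl : 0 < l) :
    Integrable (fun x : Fin n → EuclideanSpace ℝ (Fin d) => regInv (sampleCov x) l)
      (Measure.pi fun _ => D) :=
  Integrable.of_bound (continuous_regInv_sampleCov hl).aestronglyMeasurable (1 / l)
    (ae_of_all _ fun x => norm_regInv_le (posSemidef_sampleCov x) hl)

/-- The linear functional `M ↦ tr (S M)`. -/
noncomputable def traceMulCLM (S : Matrix (Fin d) (Fin d) ℝ) : Matrix (Fin d) (Fin d) ℝ →L[ℝ] ℝ :=
  LinearMap.toContinuousLinearMap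
    ((Matrix.traceLinearMap (Fin d) ℝ ℝ).comp (LinearMap.mulLeft ℝ S))

theorem traceMulCLM_apply (S M : Matrix (Fin d) (Fin d) ℝ) :
    traceMulCLM S M = (S * M).trace := rfl

theorem abs_trace_integral_sub_le (h4 : fourthMoment D < ∞) (hmean : ∫ x, x ∂D = 0)
    (hq : quadVar D < ∞) (hS : (covMatrix D).PosSemidef) (hd : 0 < d) (hn : 0 < n) {l k : ℝ}
    (hl : 0 < l) (hk : 0 ≤ k) :
    |(n : ℝ)⁻¹ * (covMatrix D * ∫ x : Fin n → EuclideanSpace ℝ (Fin d),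
        regInv (sampleCov x) l ∂(Measure.pi fun _ => D)).trace - k| ≤
      (1 + (covMatrix D).trace / (n * l)) *
        (|(1 + k) * ((n : ℝ)⁻¹ * effDim (covMatrix D) (l * (1 + k))) - k| +
        (1 + k) * (2 * ((d / n) * (1 / l) * √(quadVar D).toReal) +
          2 * ‖covMatrix D‖ / (l * n))) := by
  have hn' : (0 : ℝ) < n := Nat.cast_pos.2 hn
  set S := covMatrix D
  set μ : Measure (Fin n → EuclideanSpace ℝ (Fin d)) := Measure.pi fun _ => D with hμ
  set b := d * (1 / l) * √(quadVar D).toReal with hb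
  have hm : 0 < l * (1 + k) := by positivity
  have hR : Integrable (fun x : Fin n → EuclideanSpace ℝ (Fin d) => regInv (sampleCov x) l) μ :=
    integrable_regInv_sampleCov hl
  have h1 := fun i => integral_quadDev_leaveOneOut_le (n := n) h4 hmean hq hd hl
    (S * regInv S (l * (1 + k))) (norm_mul_regInv_le hS hm) i
  have h2 := fun i => integral_quadDev_leaveOneOut_le (n := n) h4 hmean hq hd hl
    1 (by rw [← Matrix.diagonal_one, Matrix.l2_opNorm_diagonal]
          exact (pi_norm_le_iff_of_nonneg zero_le_one).2 fun _ => by simp) i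
  simp only [mul_one] at h2
  have hκint : Integrable (fun x : Fin n → EuclideanSpace ℝ (Fin d) =>
      (n : ℝ)⁻¹ * (S * regInv (sampleCov x) l).trace - k) μ :=
    (((traceMulCLM S).integrable_comp hR).const_mul _).sub (integrable_const _)
  have e1 : (n : ℝ)⁻¹ * (S * ∫ x, regInv (sampleCov x) l ∂μ).trace - k =
      ∫ x, ((n : ℝ)⁻¹ * (S * regInv (sampleCov x) l).trace - k) ∂μ := by
    have i1 : Integrable (fun x : Fin n → EuclideanSpace ℝ (Fin d) =>
      (n : ℝ)⁻¹ * (S * regInv (sampleCov x) l).trace) μ :=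
      ((traceMulCLM S).integrable_comp hR).const_mul _
    have i2 := (traceMulCLM S).integral_comp_comm hR
    simp only [traceMulCLM_apply] at i2
    rw [integral_sub i1 (integrable_const _), integral_const_mul, i2]
    simp
  rw [e1]
  refine (abs_integral_le_integral_abs).trans ?_
  have h12 : ∀ i, Integrable (fun x : Fin n → EuclideanSpace ℝ (Fin d) =>
      (n : ℝ)⁻¹ * quadDev S (regInv (leaveOneOut x i) l * (S * regInv S (l * (1 + k)))) (x i)
        + (n : ℝ)⁻¹ * quadDev S (regInv (leaveOneOut x i) l) (x i)) μ :=
    fun i => ((h1 i).1.const_mul _).add ((h2 i).1.const_mul _)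
  have hterm : ∀ i, Integrable (fun x : Fin n → EuclideanSpace ℝ (Fin d) =>
      (n : ℝ)⁻¹ * quadDev S (regInv (leaveOneOut x i) l * (S * regInv S (l * (1 + k)))) (x i)
        + (n : ℝ)⁻¹ * quadDev S (regInv (leaveOneOut x i) l) (x i)
        + 2 * ‖S‖ / (l * n)) μ :=
    fun i => (h12 i).add (integrable_const _)
  have hsum := integrable_finsetSum Finset.univ fun i _ => hterm i
  have hbound : Integrable (fun x : Fin n → EuclideanSpace ℝ (Fin d) =>
      (1 + S.trace / (n * l)) * (|(1 + k) * ((n : ℝ)⁻¹ * effDim S (l * (1 + k))) - k| +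
        (1 + k) * ((n : ℝ)⁻¹ * ∑ i,
          ((n : ℝ)⁻¹ * quadDev S (regInv (leaveOneOut x i) l * (S * regInv S (l * (1 + k)))) (x i)
            + (n : ℝ)⁻¹ * quadDev S (regInv (leaveOneOut x i) l) (x i)
            + 2 * ‖S‖ / (l * n))))) μ :=
    ((integrable_const _).add ((hsum.const_mul _).const_mul _)).const_mul _
  refine (integral_mono hκint.abs hbound
    fun x => abs_trace_sub_le hS hn x hl hk).trans ?_
  have hTr := hS.trace_nonneg
  rw [integral_const_mul]
  refine mul_le_mul_of_nonneg_left ?_ (by positivity)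
  rw [integral_add (integrable_const _) ((hsum.const_mul _).const_mul _), integral_const_mul,
    integral_const_mul, integral_const, probReal_univ, one_smul]
  refine add_le_add le_rfl (mul_le_mul_of_nonneg_left ?_ (by positivity))
  rw [integral_finsetSum _ fun i _ => hterm i, inv_mul_le_iff₀ hn']
  calc _ ≤ ∑ _i : Fin n, (2 * ((d / n) * (1 / l) * √(quadVar D).toReal) +
          2 * ‖S‖ / (l * n)) := by
        refine Finset.sum_le_sum fun i _ => ?_
        rw [integral_add (h12 i) (integrable_const _),
          integral_add ((h1 i).1.const_mul _) ((h2 i).1.const_mul _), integral_const_mul,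
          integral_const_mul, integral_const, probReal_univ, one_smul]
        have a1 := mul_le_mul_of_nonneg_left (h1 i).2 (inv_nonneg.2 hn'.le)
        have a2 := mul_le_mul_of_nonneg_left (h2 i).2 (inv_nonneg.2 hn'.le)
        have e : (d / n) * (1 / l) * √(quadVar D).toReal = (n : ℝ)⁻¹ * b := by rw [hb]; ring
        rw [e]
        linarith
    _ = _ := by rw [Finset.sum_const, Finset.card_univ, Fintype.card_fin, nsmul_eq_mul]

end ProductMeasure

/-! ### From the probability spaces to product measures, and from the norm to traces. -/

section Transfer

variable {n d : ℕ} {D : Measure (EuclideanSpace ℝ (Fin d))}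
  {Ω : Type*} [MeasurableSpace Ω] {P : Measure Ω} [IsProbabilityMeasure P]
  {X : Fin n → Ω → EuclideanSpace ℝ (Fin d)}

theorem map_sample_eq_pi (hlaw : ∀ i, HasLaw (X i) D P) (hindep : iIndepFun X P) :
    P.map (fun ω i => X i ω) = Measure.pi fun _ => D := by
  rw [(iIndepFun_iff_map_fun_eq_pi_map fun i => (hlaw i).aemeasurable).1 hindep]
  congr 1
  funext i
  exact (hlaw i).map_eq

theorem integrable_regInv_sample (hlaw : ∀ i, HasLaw (X i) D P) {l : ℝ} (hl : 0 < l) :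
    Integrable (fun ω => regInv (sampleCov fun i => X i ω) l) P :=
  Integrable.of_bound ((continuous_regInv_sampleCov hl).aestronglyMeasurable.comp_aemeasurable
      (aemeasurable_pi_lambda _ fun i => (hlaw i).aemeasurable)) (1 / l)
    (ae_of_all _ fun _ => norm_regInv_le (posSemidef_sampleCov _) hl)

theorem integral_regInv_sample (hlaw : ∀ i, HasLaw (X i) D P) (hindep : iIndepFun X P) {l : ℝ}
    (hl : 0 < l) :
    ∫ ω, regInv (sampleCov fun i => X i ω) l ∂P =
      ∫ x : Fin n → EuclideanSpace ℝ (Fin d), regInv (sampleCov x) l ∂(Measure.pi fun _ => D) := by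
  rw [← map_sample_eq_pi hlaw hindep, integral_map
    (aemeasurable_pi_lambda _ fun i => (hlaw i).aemeasurable)
    (continuous_regInv_sampleCov hl).aestronglyMeasurable]

/-- The bias matrix is paired with `Σ` itself, because `tr (Σ E R)` is the quantity that satisfies a
closed equation. -/
theorem le_averagingBias (hlaw : ∀ i, HasLaw (X i) D P) (hindep : iIndepFun X P)
    (hS : (covMatrix D).PosSemidef) (htr : 0 < (covMatrix D).trace) {l : ℝ} (hl : 0 < l) :
    ((covMatrix D * ∫ x : Fin n → EuclideanSpace ℝ (Fin d),
        regInv (sampleCov x) l ∂(Measure.pi fun _ => D)).trace - effDim (covMatrix D) l) /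
        (covMatrix D).trace ≤ averagingBias P D X l := by
  rw [averagingBias, integral_regInv_sample hlaw hindep hl, div_le_iff₀ htr, effDim,
    ← Matrix.trace_sub, ← mul_sub]
  exact (le_abs_self _).trans (abs_trace_mul_le hS _)

theorem trace_integral_anti [IsProbabilityMeasure D] (hS : (covMatrix D).PosSemidef) {a b : ℝ} (ha : 0 < a) (hab : a ≤ b) :
    (covMatrix D * ∫ x : Fin n → EuclideanSpace ℝ (Fin d),
        regInv (sampleCov x) b ∂(Measure.pi fun _ => D)).trace ≤
      (covMatrix D * ∫ x : Fin n → EuclideanSpace ℝ (Fin d),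
        regInv (sampleCov x) a ∂(Measure.pi fun _ => D)).trace := by
  have ia := integrable_regInv_sampleCov (n := n) (D := D) ha
  have ib := integrable_regInv_sampleCov (n := n) (D := D) (ha.trans_le hab)
  rw [← traceMulCLM_apply, ← traceMulCLM_apply, ← ContinuousLinearMap.integral_comp_comm _ ia,
    ← ContinuousLinearMap.integral_comp_comm _ ib]
  exact integral_mono (ContinuousLinearMap.integrable_comp _ ib)
    (ContinuousLinearMap.integrable_comp _ ia)
    fun x => trace_mul_regInv_anti hS (posSemidef_sampleCov x) ha hab

end Transfer

end NaiveAveraging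

namespace NaiveAveraging

/-! ### The trace of the resolvent as an integral of the spectral distribution. -/

section SpectralDistribution

variable {d : ℕ} {A : Matrix (Fin d) (Fin d) ℝ}

/-- Integrating the derivative of `-1/(u + m)` from `s` to `b` puts the dependence on `s` into an
indicator of `s ≤ u`; averaging over eigenvalues then produces `esd`. -/
theorem one_div_add_eq_integral {s b m : ℝ} (hs : 0 ≤ s) (hsb : s ≤ b) (hm : 0 < m) :
    1 / (s + m) = 1 / (b + m) +
      ∫ u in Set.Icc 0 b, (if s ≤ u then (1 : ℝ) else 0) * (1 / (u + m) ^ 2) := by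
  have e : ∀ u : ℝ, (if s ≤ u then (1 : ℝ) else 0) * (1 / (u + m) ^ 2)
      = (Set.Ici s).indicator (fun u => 1 / (u + m) ^ 2) u := fun u => by
    by_cases h : s ≤ u <;> simp [h]
  simp_rw [e]
  rw [setIntegral_indicator measurableSet_Ici]
  have hset : Set.Icc 0 b ∩ Set.Ici s = Set.Icc s b := by
    ext u
    simp only [Set.mem_inter_iff, Set.mem_Icc, Set.mem_Ici]
    exact ⟨fun h => ⟨h.2, h.1.2⟩, fun h => ⟨⟨hs.trans h.1, h.2⟩, h.1⟩⟩
  rw [hset, integral_Icc_eq_integral_Ioc, ← intervalIntegral.integral_of_le hsb]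
  have hpos : ∀ u ∈ Set.uIcc s b, 0 < u + m := fun u hu => by
    rw [Set.uIcc_of_le hsb] at hu
    linarith [hu.1]
  rw [intervalIntegral.integral_eq_sub_of_hasDerivAt (f := fun u => -(1 / (u + m)))]
  · ring
  · intro u hu
    have h := (((hasDerivAt_id u).add_const m).inv (hpos u hu).ne').neg
    refine (h.congr_deriv ?_).congr_of_eventuallyEq (.of_forall fun v => ?_)
    · simp [neg_div]
    · simp
  · refine ContinuousOn.intervalIntegrable ?_
    exact continuousOn_const.div (by fun_prop) fun u hu => (pow_pos (hpos u hu) 2).ne'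

theorem esd_eq_sum (hA : A.IsHermitian) (u : ℝ) :
    esd hA u = (d : ℝ)⁻¹ * ∑ i, if hA.eigenvalues i ≤ u then (1 : ℝ) else 0 := by
  rw [esd, Finset.card_filter]
  push_cast
  rfl

theorem measurable_esd (hA : A.IsHermitian) : Measurable (esd hA) := by
  have : esd hA = fun u => (d : ℝ)⁻¹ * ∑ i, if hA.eigenvalues i ≤ u then (1 : ℝ) else 0 :=
    funext (esd_eq_sum hA)
  rw [this]
  exact (Finset.measurable_sum _ fun i _ =>
    Measurable.ite measurableSet_Ici measurable_const measurable_const).const_mul _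

theorem esd_nonneg (hA : A.IsHermitian) (u : ℝ) : 0 ≤ esd hA u := by
  rw [esd]; positivity

theorem esd_le_one (hA : A.IsHermitian) (u : ℝ) : esd hA u ≤ 1 := by
  rw [esd]
  refine inv_mul_le_one_of_le₀ ?_ (by positivity)
  have := Finset.card_filter_le (Finset.univ : Finset (Fin d)) fun i => hA.eigenvalues i ≤ u
  simpa using this

theorem integrableOn_one_div_sq {b m : ℝ} (hm : 0 < m) :
    IntegrableOn (fun u : ℝ => 1 / (u + m) ^ 2) (Set.Icc 0 b) := by
  refine ContinuousOn.integrableOn_Icc ?_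
  refine continuousOn_const.div (by fun_prop) fun u hu => ?_
  have : 0 < u + m := by linarith [hu.1]
  positivity

theorem trace_regInv_eq_integral_esd (hA : A.IsHermitian) (hp : A.PosSemidef) {b m : ℝ}
    (hm : 0 < m) (hb : ∀ i, hA.eigenvalues i ≤ b) (hd : 0 < d) :
    (d : ℝ)⁻¹ * (regInv A m).trace =
      1 / (b + m) + ∫ u in Set.Icc 0 b, esd hA u * (1 / (u + m) ^ 2) := by
  have hd' : (d : ℝ) ≠ 0 := (Nat.cast_pos.2 hd).ne'
  rw [trace_regInv_eq_sum hA hp hm]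
  simp_rw [fun i => one_div_add_eq_integral (hp.eigenvalues_nonneg i) (hb i) hm]
  rw [Finset.sum_add_distrib, Finset.sum_const, Finset.card_univ, Fintype.card_fin, nsmul_eq_mul,
    mul_add, inv_mul_cancel_left₀ hd']
  congr 1
  simp_rw [esd_eq_sum, mul_assoc, Finset.sum_mul]
  rw [integral_const_mul, integral_finsetSum]
  intro i _
  refine Integrable.mono (integrableOn_one_div_sq hm) ?_ (ae_of_all _ fun u => ?_)
  · exact (Measurable.aestronglyMeasurable
      ((Measurable.ite measurableSet_Ici measurable_const measurable_const).mul (by fun_prop)))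
  · by_cases h : hA.eigenvalues i ≤ u <;> simp [h, sq_nonneg]

end SpectralDistribution

/-! ### Limits of effective dimensions and the fixed point equation. -/

section Limits

variable {d : ℕ → ℕ} {D : ∀ n, Measure (EuclideanSpace ℝ (Fin (d n)))} {F : ℝ → ℝ}
  {y smin smax : ℝ}

theorem StandingAssumptions.posSemidef (hA : StandingAssumptions D F smin smax) (n : ℕ) :
    (covMatrix (D n)).PosSemidef :=
  (covMatrix_isHermitian (D n)).posSemidef_iff_eigenvalues_nonneg.2 fun i =>
    hA.smin_pos.le.trans (hA.eigenvalues_mem n i).1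

theorem StandingAssumptions.le_trace (hA : StandingAssumptions D F smin smax) (n : ℕ) :
    d n * smin ≤ (covMatrix (D n)).trace := by
  rw [(covMatrix_isHermitian (D n)).trace_eq_sum_eigenvalues]
  calc (d n : ℝ) * smin = ∑ _i : Fin (d n), smin := by simp
    _ ≤ _ := Finset.sum_le_sum fun i _ => (hA.eigenvalues_mem n i).1

theorem StandingAssumptions.trace_le (hA : StandingAssumptions D F smin smax) (n : ℕ) :
    (covMatrix (D n)).trace ≤ d n * smax := by
  rw [(covMatrix_isHermitian (D n)).trace_eq_sum_eigenvalues]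
  calc _ ≤ ∑ _i : Fin (d n), smax := Finset.sum_le_sum fun i _ => (hA.eigenvalues_mem n i).2
    _ = (d n : ℝ) * smax := by simp

theorem StandingAssumptions.smin_le_smax (hA : StandingAssumptions D F smin smax)
    (hd : Tendsto d atTop atTop) : smin ≤ smax := by
  obtain ⟨n, hn⟩ := (hd.eventually_gt_atTop 0).exists
  have := hA.eigenvalues_mem n ⟨0, hn⟩
  exact this.1.trans this.2

theorem StandingAssumptions.norm_covMatrix_le (hA : StandingAssumptions D F smin smax)
    (hs : 0 ≤ smax) (n : ℕ) : ‖covMatrix (D n)‖ ≤ smax :=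
  norm_le_of_eigenvalues_le (covMatrix_isHermitian (D n)) hs fun i => by
    rw [abs_of_nonneg (hA.smin_pos.le.trans (hA.eigenvalues_mem n i).1)]
    exact (hA.eigenvalues_mem n i).2

/-- Dominated convergence in the integral against `esd`, which is bounded by one on the fixed
interval `[0, smax]`. It makes the lower limit in `limEffDim` a true limit. -/
theorem StandingAssumptions.exists_tendsto_trace_regInv (hA : StandingAssumptions D F smin smax)
    (hd : Tendsto d atTop atTop)
    (hdn : Tendsto (fun n : ℕ => (d n : ℝ) / (n : ℝ)) atTop (𝓝 y)) {m : ℝ} (hm : 0 < m) :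
    ∃ t : ℝ, Tendsto (fun n : ℕ => (n : ℝ)⁻¹ * (regInv (covMatrix (D n)) m).trace) atTop (𝓝 t) := by
  have hF : ∀ᵐ u ∂(volume.restrict (Set.Icc (0 : ℝ) smax)),
      Tendsto (fun n => esd (covMatrix_isHermitian (D n)) u) atTop (𝓝 (F u)) :=
    ae_restrict_of_ae_restrict_of_subset Set.Icc_subset_Ici_self hA.esd_tendsto
  have h1 := tendsto_integral_of_dominated_convergence (μ := volume.restrict (Set.Icc 0 smax))
    (F := fun n u => esd (covMatrix_isHermitian (D n)) u * (1 / (u + m) ^ 2))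
    (f := fun u => F u * (1 / (u + m) ^ 2)) (fun u => 1 / (u + m) ^ 2)
    (fun n => ((measurable_esd _).mul (by fun_prop)).aestronglyMeasurable)
    (integrableOn_one_div_sq hm)
    (fun n => ae_of_all _ fun u => by
      rw [norm_mul, Real.norm_of_nonneg (esd_nonneg _ _),
        Real.norm_of_nonneg (by positivity : 0 ≤ 1 / (u + m) ^ 2)]
      exact mul_le_of_le_one_left (by positivity) (esd_le_one _ _))
    (hF.mono fun u hu => hu.mul_const _)
  have h2 := hdn.mul (h1.const_add (1 / (smax + m)))
  refine ⟨_, h2.congr' ?_⟩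
  filter_upwards [hd.eventually_gt_atTop 0] with n hn
  have hn' : (d n : ℝ) ≠ 0 := (Nat.cast_pos.2 hn).ne'
  rw [← trace_regInv_eq_integral_esd (covMatrix_isHermitian (D n)) (hA.posSemidef n) hm
    (fun i => (hA.eigenvalues_mem n i).2) hn]
  field_simp

theorem StandingAssumptions.tendsto_effDim (hA : StandingAssumptions D F smin smax)
    (hdn : Tendsto (fun n : ℕ => (d n : ℝ) / (n : ℝ)) atTop (𝓝 y)) {m t : ℝ} (hm : 0 < m)
    (ht : Tendsto (fun n : ℕ => (n : ℝ)⁻¹ * (regInv (covMatrix (D n)) m).trace) atTop (𝓝 t)) :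
    Tendsto (fun n : ℕ => (n : ℝ)⁻¹ * effDim (covMatrix (D n)) m) atTop (𝓝 (y - m * t)) := by
  refine (hdn.sub (ht.const_mul m)).congr fun n => ?_
  rw [effDim_eq (hA.posSemidef n) hm]
  ring

theorem StandingAssumptions.tendsto_limEffDim (hA : StandingAssumptions D F smin smax)
    (hd : Tendsto d atTop atTop)
    (hdn : Tendsto (fun n : ℕ => (d n : ℝ) / (n : ℝ)) atTop (𝓝 y)) {m : ℝ} (hm : 0 < m) :
    Tendsto (fun n : ℕ => (n : ℝ)⁻¹ * effDim (covMatrix (D n)) m) atTop (𝓝 (limEffDim D m)) := by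
  obtain ⟨t, ht⟩ := hA.exists_tendsto_trace_regInv hd hdn hm
  have h := hA.tendsto_effDim hdn hm ht
  rwa [limEffDim, h.liminf_eq]

theorem StandingAssumptions.le_limEffDim (hA : StandingAssumptions D F smin smax)
    (hd : Tendsto d atTop atTop)
    (hdn : Tendsto (fun n : ℕ => (d n : ℝ) / (n : ℝ)) atTop (𝓝 y)) {m : ℝ} (hm : 0 < m) :
    y * (smin / (smin + m)) ≤ limEffDim D m := by
  refine le_of_tendsto_of_tendsto' (hdn.mul_const _) (hA.tendsto_limEffDim hd hdn hm) fun n => ?_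
  have hs := hA.smin_pos
  rw [effDim_eq_sum (covMatrix_isHermitian (D n)) (hA.posSemidef n) hm, div_eq_inv_mul, mul_assoc]
  refine mul_le_mul_of_nonneg_left ?_ (by positivity)
  calc (d n : ℝ) * (smin / (smin + m)) = ∑ _i : Fin (d n), smin / (smin + m) := by simp
    _ ≤ _ := Finset.sum_le_sum fun i _ => by
      have h := (hA.eigenvalues_mem n i).1
      rw [div_le_div_iff₀ (by positivity) (by linarith)]
      nlinarith

theorem StandingAssumptions.limEffDim_le (hA : StandingAssumptions D F smin smax)
    (hd : Tendsto d atTop atTop)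
    (hdn : Tendsto (fun n : ℕ => (d n : ℝ) / (n : ℝ)) atTop (𝓝 y)) {m : ℝ} (hm : 0 < m) :
    limEffDim D m ≤ y := by
  refine le_of_tendsto_of_tendsto' (hA.tendsto_limEffDim hd hdn hm) hdn fun n => ?_
  rw [effDim_eq (hA.posSemidef n) hm, div_eq_inv_mul]
  refine mul_le_mul_of_nonneg_left ?_ (by positivity)
  have := mul_nonneg hm.le (posDef_regInv (hA.posSemidef n) hm).posSemidef.trace_nonneg
  linarith

/-- Each summand `s/(s + a)` is Lipschitz in `a ≥ l` with constant `1/l`, and there are `d ~ y n` of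
them. This supplies the continuity for the fixed point equation. -/
theorem StandingAssumptions.abs_limEffDim_sub_le (hA : StandingAssumptions D F smin smax)
    (hd : Tendsto d atTop atTop)
    (hdn : Tendsto (fun n : ℕ => (d n : ℝ) / (n : ℝ)) atTop (𝓝 y)) {l a b : ℝ} (hl : 0 < l)
    (ha : l ≤ a) (hb : l ≤ b) :
    limEffDim D a ≤ limEffDim D b + y / l * |a - b| := by
  have ha0 := hl.trans_le ha
  have hb0 := hl.trans_le hb
  refine le_of_tendsto_of_tendsto' (hA.tendsto_limEffDim hd hdn ha0)
    ((hA.tendsto_limEffDim hd hdn hb0).add ((hdn.div_const l).mul_const |a - b|)) fun n => ?_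
  have hsum : effDim (covMatrix (D n)) a ≤ effDim (covMatrix (D n)) b + d n * (|a - b| / l) := by
    rw [effDim_eq_sum (covMatrix_isHermitian (D n)) (hA.posSemidef n) ha0,
      effDim_eq_sum (covMatrix_isHermitian (D n)) (hA.posSemidef n) hb0]
    calc _ ≤ ∑ i, ((covMatrix_isHermitian (D n)).eigenvalues i /
          ((covMatrix_isHermitian (D n)).eigenvalues i + b) + |a - b| / l) := by
          refine Finset.sum_le_sum fun i _ => ?_
          have hs := hA.smin_pos.trans_le (hA.eigenvalues_mem n i).1
          generalize (covMatrix_isHermitian (D n)).eigenvalues i = s at hs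
          have e : s / (s + a) - s / (s + b) = s / (s + a) * ((b - a) / (s + b)) := by
            field_simp
            ring
          have h1 : s / (s + a) ≤ 1 := (div_le_one (by positivity)).2 (by linarith)
          have h2 : (b - a) / (s + b) ≤ |a - b| / l := by
            rw [abs_sub_comm]
            exact div_le_div₀ (abs_nonneg _) (le_abs_self _) hl (by linarith)
          have h3 : s / (s + a) * ((b - a) / (s + b)) ≤ s / (s + a) * (|a - b| / l) :=
            mul_le_mul_of_nonneg_left h2 (by positivity)
          have h4 : s / (s + a) * (|a - b| / l) ≤ |a - b| / l :=
            mul_le_of_le_one_left (by positivity) h1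
          linarith
      _ = _ := by rw [Finset.sum_add_distrib]; simp
  have := mul_le_mul_of_nonneg_left hsum (inv_nonneg.2 (Nat.cast_nonneg (α := ℝ) n))
  calc _ ≤ _ := this
    _ = _ := by ring

/-- Intermediate value theorem for `m (1 - limEffDim D m)` on `[l, l/(1 - y)]`: since `0 ≤ limEffDim
≤ y`, the value is at most `l` at the left end and at least `l` at the right end. -/
theorem StandingAssumptions.exists_fixedPoint (hA : StandingAssumptions D F smin smax)
    (hy0 : 0 ≤ y) (hy1 : y < 1) (hd : Tendsto d atTop atTop)
    (hdn : Tendsto (fun n : ℕ => (d n : ℝ) / (n : ℝ)) atTop (𝓝 y)) {l : ℝ} (hl : 0 < l) :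
    ∃ l' : ℝ, 0 < l' ∧ l = l' * (1 - limEffDim D l') := by
  have hle : l ≤ l / (1 - y) := le_div_self hl.le (by linarith) (by linarith)
  have hcont : ContinuousOn (limEffDim D) (Set.Icc l (l / (1 - y))) :=
    (LipschitzOnWith.of_le_add_mul' (y / l) fun a ha b hb => by
      rw [Real.dist_eq]
      exact hA.abs_limEffDim_sub_le hd hdn hl ha.1 hb.1).continuousOn
  have hg : ContinuousOn (fun m => m * (1 - limEffDim D m)) (Set.Icc l (l / (1 - y))) :=
    continuousOn_id.mul (continuousOn_const.sub hcont)
  have hmem : l ∈ Set.Icc (l * (1 - limEffDim D l))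
      (l / (1 - y) * (1 - limEffDim D (l / (1 - y)))) := by
    have hs := hA.smin_pos
    constructor
    · have h : 0 ≤ limEffDim D l := le_trans (by positivity) (hA.le_limEffDim hd hdn hl)
      nlinarith
    · have hpos : 0 < l / (1 - y) := hl.trans_le hle
      have h := hA.limEffDim_le hd hdn hpos
      calc l = l / (1 - y) * (1 - y) := (div_mul_cancel₀ _ (by linarith)).symm
        _ ≤ _ := mul_le_mul_of_nonneg_left (by linarith) hpos.le
  obtain ⟨m, hm, he⟩ := intermediate_value_Icc hle hg hmem
  exact ⟨m, hl.trans_le hm.1, he.symm⟩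

/-- For one eigenvalue `s` the gap `(m/l) s/(s + m) - s/(s + l)` equals `s/(s + l) · (m - l)/(l (s +
m)) · s`. Bounding all but the last factor uniformly and summing leaves a multiple of the trace. -/
theorem StandingAssumptions.effDim_add_le (hA : StandingAssumptions D F smin smax) {l m : ℝ}
    (hl : 0 < l) (hlm : l ≤ m) (n : ℕ) :
    effDim (covMatrix (D n)) l +
        smin / (smax + l) * ((m - l) / (l * (smax + m))) * (covMatrix (D n)).trace ≤
      m / l * effDim (covMatrix (D n)) m := by
  have hm := hl.trans_le hlm
  rw [effDim_eq_sum (covMatrix_isHermitian (D n)) (hA.posSemidef n) hl,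
    effDim_eq_sum (covMatrix_isHermitian (D n)) (hA.posSemidef n) hm,
    (covMatrix_isHermitian (D n)).trace_eq_sum_eigenvalues, Finset.mul_sum, Finset.mul_sum,
    ← Finset.sum_add_distrib]
  refine Finset.sum_le_sum fun i _ => ?_
  have h := hA.eigenvalues_mem n i
  have hs := hA.smin_pos
  simp only [RCLike.ofReal_real_eq_id, id_eq]
  generalize (covMatrix_isHermitian (D n)).eigenvalues i = s at h
  have hspos : 0 < s := hs.trans_le h.1
  have hmax : 0 < smax := hspos.trans_le h.2
  have e : m / l * (s / (s + m)) - s / (s + l) =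
      s / (s + l) * ((m - l) / (l * (s + m))) * s := by
    field_simp
    ring
  have h1 : smin / (smax + l) * ((m - l) / (l * (smax + m))) * s ≤
      s / (s + l) * ((m - l) / (l * (s + m))) * s := by
    have := sub_nonneg.2 hlm
    have h1 := h.1
    have h2 := h.2
    gcongr
  linarith

variable [∀ n, IsProbabilityMeasure (D n)]

/-- The self-consistent equation determines the limit of `tr (Σ E (Σ̂ + l I)⁻¹) / n`. -/
theorem StandingAssumptions.tendsto_trace_integral (hA : StandingAssumptions D F smin smax)
    (hmean : ∀ n, ∫ x, x ∂(D n) = 0) (hd : Tendsto d atTop atTop)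
    (hdn : Tendsto (fun n : ℕ => (d n : ℝ) / (n : ℝ)) atTop (𝓝 y)) {l k : ℝ} (hl : 0 < l)
    (hk : 0 ≤ k) (hlk : (1 + k) * limEffDim D (l * (1 + k)) = k) :
    Tendsto (fun n : ℕ => (n : ℝ)⁻¹ * (covMatrix (D n) *
      ∫ x : Fin n → EuclideanSpace ℝ (Fin (d n)), regInv (sampleCov x) l
        ∂(Measure.pi fun _ => D n)).trace) atTop (𝓝 k) := by
  have hsm := hA.smin_le_smax hd
  have hs0 : 0 ≤ smax := hA.smin_pos.le.trans hsm
  have hm : 0 < l * (1 + k) := by positivity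
  rw [tendsto_iff_norm_sub_tendsto_zero]
  have hquad : Tendsto (fun n => √(quadVar (D n)).toReal) atTop (𝓝 0) := by
    have h := (ENNReal.tendsto_toReal ENNReal.zero_ne_top).comp hA.quadVar_tendsto
    simpa using h.sqrt
  have hinv : Tendsto (fun n : ℕ => 2 * smax / l * (n : ℝ)⁻¹) atTop (𝓝 0) := by
    simpa using tendsto_natCast_atTop_atTop.inv_tendsto_atTop.const_mul (2 * smax / l)
  -- Three errors vanish: the defect in the fixed point equation by `hlk`, the fluctuation of
  -- quadratic forms by `quadVar_tendsto`, and the `O(1/n)` cost of removing a sample.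
  have hbound : Tendsto (fun n : ℕ => (1 + (d n : ℝ) / n * (smax / l)) *
      (|(1 + k) * ((n : ℝ)⁻¹ * effDim (covMatrix (D n)) (l * (1 + k))) - k| +
        (1 + k) * (2 * ((d n / n) * (1 / l) * √(quadVar (D n)).toReal) +
          2 * smax / l * (n : ℝ)⁻¹))) atTop (𝓝 0) := by
    have h1 := (((hA.tendsto_limEffDim hd hdn hm).const_mul (1 + k)).sub_const k).abs
    have h2 := (((hdn.mul_const (1 / l)).mul hquad).const_mul 2).add hinv
    have h3 := ((hdn.mul_const (smax / l)).const_add 1).mul (h1.add (h2.const_mul (1 + k)))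
    simpa [hlk] using h3
  refine squeeze_zero' (.of_forall fun n => norm_nonneg _) ?_ hbound
  filter_upwards [hd.eventually_gt_atTop 0, eventually_gt_atTop 0,
    hA.quadVar_tendsto.eventually (gt_mem_nhds (ENNReal.zero_lt_top))] with n hdn0 hn0 hq
  have h4 : fourthMoment (D n) < ∞ :=
    (le_iSup (fun n => fourthMoment (D n)) n).trans_lt hA.fourthMoment_lt_top
  have hn' : (0 : ℝ) < n := Nat.cast_pos.2 hn0
  refine (abs_trace_integral_sub_le h4 (hmean n) hq (hA.posSemidef n) hdn0 hn0 hl hk).trans ?_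
  have e1 : (covMatrix (D n)).trace / (n * l) ≤ (d n : ℝ) / n * (smax / l) := by
    rw [div_mul_div_comm]
    have := hA.trace_le n
    gcongr
  have e2 : 2 * ‖covMatrix (D n)‖ / (l * n) ≤ 2 * smax / l * (n : ℝ)⁻¹ := by
    have := hA.norm_covMatrix_le hs0 n
    rw [← div_eq_mul_inv, div_div]
    gcongr
  have := (hA.posSemidef n).trace_nonneg
  gcongr

/-- Extended reals keep the lower limit meaningful even if the bias is unbounded. -/
theorem le_liminf_coe_of_tendsto {f h : ℕ → ℝ} {c : ℝ} (hc : Tendsto h atTop (𝓝 c))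
    (hle : ∀ᶠ n in atTop, h n ≤ f n) :
    (c : EReal) ≤ liminf (fun n => (f n : EReal)) atTop := by
  rw [← ((continuous_coe_real_ereal.tendsto c).comp hc).liminf_eq]
  exact liminf_le_liminf (hle.mono fun n hn => EReal.coe_le_coe_iff.2 hn)

/-! ### The two lower bounds on the bias. -/

variable {Ω : ℕ → Type*} [∀ n, MeasurableSpace (Ω n)] {P : ∀ n, Measure (Ω n)}
  [∀ n, IsProbabilityMeasure (P n)] {X : ∀ n, Fin n → Ω n → EuclideanSpace ℝ (Fin (d n))}

theorem StandingAssumptions.le_liminf_averagingBias_of_tendsto_zero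
    (hA : StandingAssumptions D F smin smax) (hy0 : 0 ≤ y) (hy1 : y < 1)
    (hmean : ∀ n, ∫ x, x ∂(D n) = 0) (hd : Tendsto d atTop atTop)
    (hdn : Tendsto (fun n : ℕ => (d n : ℝ) / (n : ℝ)) atTop (𝓝 y))
    (hlaw : ∀ n i, HasLaw (X n i) (D n) (P n)) (hindep : ∀ n, iIndepFun (X n) (P n))
    {l : ℕ → ℝ} (hl : ∀ n, 0 < l n) (hl0 : Tendsto l atTop (𝓝 0)) :
    ((y * smin / smax ^ 2 : ℝ) : EReal) ≤
        liminf (fun n => ((averagingBias (P n) (D n) (X n) (l n) : ℝ) : EReal)) atTop := by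
  -- For `y = 0` the bound is zero; the general argument divides by `y`.
  rcases hy0.eq_or_lt with rfl | hy
  · refine le_liminf_coe_of_tendsto tendsto_const_nhds (.of_forall fun n => ?_)
    rw [zero_mul, zero_div]
    exact norm_nonneg _
  have hsm := hA.smin_le_smax hd
  have hs := hA.smin_pos
  have hs0 : 0 < smax := hs.trans_le hsm
  -- a regularization level at which the limiting bias is large enough
  obtain ⟨m, hm, hmk⟩ : ∃ m : ℝ, 0 < m ∧
      y + y ^ 2 ≤ limEffDim D m / (1 - limEffDim D m) := by
    have hr : Tendsto (fun m : ℝ => y * (smin / (smin + m))) (𝓝[>] 0) (𝓝 y) := by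
      have : ContinuousAt (fun m : ℝ => y * (smin / (smin + m))) 0 :=
        continuousAt_const.mul (continuousAt_const.div (by fun_prop) (by simp [hs.ne']))
      have h := this.tendsto
      rw [add_zero, div_self hs.ne', mul_one] at h
      exact h.mono_left nhdsWithin_le_nhds
    have hr2 := hr.div (hr.const_sub 1) (sub_pos.2 hy1).ne'
    -- The geometric series `y + y² + y³ + ...` cut after two terms leaves room, so a positive `m`
    -- suffices instead of the limit `m → 0`.
    have hlt : y + y ^ 2 < y / (1 - y) := by
      rw [lt_div_iff₀ (by linarith)]
      nlinarith [pow_pos hy 3]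
    obtain ⟨m, h1, h2⟩ := ((hr2.eventually (lt_mem_nhds hlt)).and self_mem_nhdsWithin).exists
    refine ⟨m, h2, h1.le.trans ?_⟩
    have h3 := hA.le_limEffDim hd hdn h2
    have h4 := hA.limEffDim_le hd hdn h2
    have h2' : (0 : ℝ) < m := h2
    have h5 : 0 ≤ y * (smin / (smin + m)) := by positivity
    exact div_le_div₀ (h5.trans h3) h3 (by linarith) (by linarith)
  set e := limEffDim D m with he
  have he1 : e ≤ y := hA.limEffDim_le hd hdn hm
  have he0 : 0 ≤ e := le_trans (by positivity) (hA.le_limEffDim hd hdn hm)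
  have h1e : 0 < 1 - e := by linarith
  -- The level is chosen backwards, so that `m` solves the fixed point equation for `a`; the trace
  -- at level `a` then has limit `e/(1 - e)`.
  set a := m * (1 - e) with ha
  have ha0 : 0 < a := mul_pos hm h1e
  set k := e / (1 - e) with hk
  have hk0 : 0 ≤ k := div_nonneg he0 h1e.le
  have h1k : 1 + k = 1 / (1 - e) := by rw [hk]; field_simp; ring
  have hak : a * (1 + k) = m := by rw [ha, h1k]; field_simp
  have hlim := hA.tendsto_trace_integral hmean hd hdn ha0 hk0
    (by rw [hak, ← he, h1k, hk]; ring)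
  have hnd : Tendsto (fun n : ℕ => ((d n : ℝ) / n)⁻¹ / smax) atTop (𝓝 (y⁻¹ / smax)) :=
    (hdn.inv₀ hy.ne').div_const _
  have hdiff := hlim.sub hdn
  have hfin := hnd.mul hdiff
  have hbd : y * smin / smax ^ 2 ≤ y⁻¹ / smax * (k - y) := by
    have h1 : y * smin / smax ^ 2 ≤ y / smax := by
      rw [div_le_div_iff₀ (by positivity) hs0]
      nlinarith [mul_le_mul_of_nonneg_left hsm (mul_pos hy hs0).le]
    have h2 : y / smax = y⁻¹ / smax * y ^ 2 := by field_simp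
    rw [h2] at h1
    exact h1.trans (mul_le_mul_of_nonneg_left (by linarith) (by positivity))
  refine (EReal.coe_le_coe_iff.2 hbd).trans (le_liminf_coe_of_tendsto hfin ?_)
  have hky : 0 < k - y := by nlinarith [pow_pos hy 2]
  filter_upwards [hd.eventually_gt_atTop 0, eventually_gt_atTop 0,
    hl0.eventually (ge_mem_nhds ha0), hdiff.eventually (lt_mem_nhds hky)] with n hdn0 hn0 hla hpos
  have hn' : (0 : ℝ) < n := Nat.cast_pos.2 hn0
  have hd' : (0 : ℝ) < d n := Nat.cast_pos.2 hdn0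
  have htr : 0 < (covMatrix (D n)).trace := (mul_pos hd' hs).trans_le (hA.le_trace n)
  refine le_trans ?_ (le_averagingBias (hlaw n) (hindep n) (hA.posSemidef n) htr (hl n))
  -- Eventually `l n ≤ a`, so monotonicity reduces the moving level to the fixed one; the population
  -- term is bounded by `d n`.
  have h1 := trace_integral_anti (n := n) (hA.posSemidef n) (hl n) hla
  have h2 : effDim (covMatrix (D n)) (l n) ≤ d n := by
    rw [effDim_eq (hA.posSemidef n) (hl n)]
    have := mul_nonneg (hl n).le (posDef_regInv (hA.posSemidef n) (hl n)).posSemidef.trace_nonneg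
    linarith
  set κ := (covMatrix (D n) * ∫ x : Fin n → EuclideanSpace ℝ (Fin (d n)), regInv (sampleCov x) a
        ∂(Measure.pi fun _ => D n)).trace with hκ
  have e1 : (n : ℝ)⁻¹ * κ - d n / n = (κ - d n) / n := by ring
  rw [e1] at hpos ⊢
  have h3 : 0 < κ - d n := by
    rcases (div_pos_iff.1 hpos) with h | h
    · exact h.1
    · linarith [h.2]
  calc ((d n : ℝ) / n)⁻¹ / smax * ((κ - d n) / n) = (κ - d n) / (d n * smax) := by field_simp
    _ ≤ (κ - d n) / (covMatrix (D n)).trace :=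
        div_le_div_of_nonneg_left h3.le htr (hA.trace_le n)
    _ ≤ _ := by gcongr

theorem StandingAssumptions.le_liminf_averagingBias (hA : StandingAssumptions D F smin smax)
    (hy0 : 0 ≤ y) (hy1 : y < 1) (hmean : ∀ n, ∫ x, x ∂(D n) = 0) (hd : Tendsto d atTop atTop)
    (hdn : Tendsto (fun n : ℕ => (d n : ℝ) / (n : ℝ)) atTop (𝓝 y))
    (hlaw : ∀ n i, HasLaw (X n i) (D n) (P n)) (hindep : ∀ n, iIndepFun (X n) (P n))
    {l m : ℝ} (hl : 0 < l) (hm : 0 < m) (hlm : l = m * (1 - limEffDim D m)) :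
    ((smin / (smax + l) * (m / (l * (smax + m)) * limEffDim D m) : ℝ) : EReal) ≤
      liminf (fun n => ((averagingBias (P n) (D n) (X n) l : ℝ) : EReal)) atTop := by
  have he1 := hA.limEffDim_le hd hdn hm
  have hs := hA.smin_pos
  have he0 : 0 ≤ limEffDim D m := le_trans (by positivity) (hA.le_limEffDim hd hdn hm)
  set e := limEffDim D m with he
  rcases hy0.eq_or_lt with rfl | hy
  · refine le_liminf_coe_of_tendsto tendsto_const_nhds (.of_forall fun n => ?_)
    rw [le_antisymm he1 he0, mul_zero, mul_zero]
    exact norm_nonneg _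
  have hle : l ≤ m := by nlinarith
  -- This inverts `m = l (1 + k)`; the equation `l = m (1 - e)` then becomes `(1 + k) e = k`.
  set k := m / l - 1 with hk
  have hk0 : 0 ≤ k := by rw [hk, sub_nonneg, one_le_div hl]; exact hle
  have h1k : 1 + k = m / l := by rw [hk]; ring
  have hlk : l * (1 + k) = m := by rw [h1k]; field_simp
  have hfix : (1 + k) * limEffDim D (l * (1 + k)) = k := by
    rw [hlk, h1k, ← he, hk]
    field_simp
    linarith
  have hlim := hA.tendsto_trace_integral hmean hd hdn hl hk0 hfix
  have heff := (hA.tendsto_limEffDim hd hdn hm).const_mul (1 + k)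
  rw [hlk] at hfix
  rw [hfix] at heff
  -- Both sequences have limit `k`, so `tr (Σ E R)` may be replaced by `(m/l)` times the effective
  -- dimension at `m`, to which `effDim_add_le` applies.
  have hdiff := (hlim.sub heff).abs
  rw [sub_self, abs_zero] at hdiff
  have hnd : Tendsto (fun n : ℕ => ((d n : ℝ) / n)⁻¹ / smin) atTop (𝓝 (y⁻¹ / smin)) :=
    (hdn.inv₀ hy.ne').div_const _
  set c := smin / (smax + l) * ((m - l) / (l * (smax + m))) with hc
  have hfin := (hnd.mul hdiff).const_sub c
  rw [mul_zero, sub_zero] at hfin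
  have hce : smin / (smax + l) * (m / (l * (smax + m)) * e) = c := by
    have : m - l = m * e := by rw [hlm]; ring
    rw [hc, this]
    ring
  rw [hce]
  refine le_liminf_coe_of_tendsto hfin ?_
  filter_upwards [hd.eventually_gt_atTop 0, eventually_gt_atTop 0] with n hdn0 hn0
  have hn' : (0 : ℝ) < n := Nat.cast_pos.2 hn0
  have hd' : (0 : ℝ) < d n := Nat.cast_pos.2 hdn0
  have htr : 0 < (covMatrix (D n)).trace := (mul_pos hd' hs).trans_le (hA.le_trace n)
  refine le_trans ?_ (le_averagingBias (hlaw n) (hindep n) (hA.posSemidef n) htr hl)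
  have h1 := hA.effDim_add_le hl hle n
  set κ := (covMatrix (D n) * ∫ x : Fin n → EuclideanSpace ℝ (Fin (d n)), regInv (sampleCov x) l
        ∂(Measure.pi fun _ => D n)).trace with hκ
  have e1 : (n : ℝ)⁻¹ * κ - (1 + k) * ((n : ℝ)⁻¹ * effDim (covMatrix (D n)) m) =
      (κ - m / l * effDim (covMatrix (D n)) m) / n := by rw [h1k]; ring
  rw [e1, abs_div, abs_of_pos hn', le_div_iff₀ htr]
  set δ := κ - m / l * effDim (covMatrix (D n)) m with hδ
  have e2 : ((d n : ℝ) / n)⁻¹ / smin * (|δ| / n) = |δ| / (d n * smin) := by field_simp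
  rw [e2, sub_mul]
  have h2 : |δ| ≤ |δ| / (d n * smin) * (covMatrix (D n)).trace := by
    rw [div_mul_eq_mul_div, le_div_iff₀ (by positivity)]
    exact mul_le_mul_of_nonneg_left (hA.le_trace n) (abs_nonneg _)
  have h3 := neg_abs_le δ
  linarith

end Limits

end NaiveAveraging

theorem mainTheorem2
    (d : ℕ → ℕ) (y : ℝ) (hy0 : 0 ≤ y) (hy1 : y < 1)
    (hd : Tendsto d atTop atTop)
    (hdn : Tendsto (fun n : ℕ => (d n : ℝ) / (n : ℝ)) atTop (𝓝 y))
    (D : ∀ n, Measure (EuclideanSpace ℝ (Fin (d n)))) [∀ n, IsProbabilityMeasure (D n)]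
    (hmean : ∀ n, ∫ x, x ∂(D n) = 0)
    (F : ℝ → ℝ) (smin smax : ℝ)
    (hA : StandingAssumptions D F smin smax)
    (Ω : ℕ → Type*) [∀ n, MeasurableSpace (Ω n)]
    (P : ∀ n, Measure (Ω n)) [∀ n, IsProbabilityMeasure (P n)]
    (X : ∀ n, Fin n → Ω n → EuclideanSpace ℝ (Fin (d n)))
    (hlaw : ∀ n i, HasLaw (X n i) (D n) (P n))
    (hindep : ∀ n, iIndepFun (X n) (P n)) :
    -- all the expectations of the regularized inverses exist
    (∀ (n : ℕ) (l : ℝ), 0 < l →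
      Integrable (fun ω => regInv (sampleCov fun i => X n i ω) l) (P n)) ∧
    -- vanishing regularization
    (∀ l : ℕ → ℝ, (∀ n, 0 < l n) → Tendsto l atTop (𝓝 0) →
      ((y * smin / smax ^ 2 : ℝ) : EReal) ≤
        liminf (fun n => ((averagingBias (P n) (D n) (X n) (l n) : ℝ) : EReal)) atTop) ∧
    -- fixed positive regularization
    (∀ l : ℝ, 0 < l →
      (∃ l' : ℝ, 0 < l' ∧ l = l' * (1 - limEffDim D l')) ∧
      ∀ l' : ℝ, 0 < l' → l = l' * (1 - limEffDim D l') →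
        ∃ t : ℝ,
          Tendsto (fun n : ℕ => (n : ℝ)⁻¹ * (regInv (covMatrix (D n)) l').trace) atTop (𝓝 t) ∧
          ((smin / (smax + l) * (l' / (l * (smax + l'))) * |y - l' * t| : ℝ) : EReal) ≤
            liminf (fun n => ((averagingBias (P n) (D n) (X n) l : ℝ) : EReal)) atTop ∧
          l' * smin * y / (l * (smax + l) * (smax + l')) * (smin / (smin + l')) ≤
            smin / (smax + l) * (l' / (l * (smax + l'))) * |y - l' * t|) := by
  refine ⟨fun n l hl => integrable_regInv_sample (hlaw n) hl, fun l hl hl0 =>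
    hA.le_liminf_averagingBias_of_tendsto_zero hy0 hy1 hmean hd hdn hlaw hindep hl hl0,
    fun l hl => ⟨hA.exists_fixedPoint hy0 hy1 hd hdn hl, fun m hm hlm => ?_⟩⟩
  obtain ⟨t, ht⟩ := hA.exists_tendsto_trace_regInv hd hdn hm
  -- Both sides are limits of the normalized effective dimension; it is nonnegative, so the absolute
  -- value in the bound disappears.
  have hlimit : y - m * t = limEffDim D m :=
    tendsto_nhds_unique (hA.tendsto_effDim hdn hm ht) (hA.tendsto_limEffDim hd hdn hm)
  have hle := hA.le_limEffDim hd hdn hm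
  have hs := hA.smin_pos
  have hmax : 0 < smax := hs.trans_le (hA.smin_le_smax hd)
  have h0 : 0 ≤ limEffDim D m := le_trans (by positivity) hle
  refine ⟨t, ht, ?_, ?_⟩
  · rw [hlimit, abs_of_nonneg h0, mul_assoc]
    exact hA.le_liminf_averagingBias hy0 hy1 hmean hd hdn hlaw hindep hl hm hlm
  · rw [hlimit, abs_of_nonneg h0]
    calc _ = smin / (smax + l) * (m / (l * (smax + m))) * (y * (smin / (smin + m))) := by
          field_simp
      _ ≤ _ := mul_le_mul_of_nonneg_left hle (by positivity)
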